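/- Let $\mathcal K$ be a complex Hilbert space, $\mathcal H=L^2(0,\infty)\otimes\mathcal K$, and let $\{s_t\}_{t\ge0}$ be the semigroup of right shifts on $\mathcal H$. Let $\mathcal F_-(\mathcal H)$ be the antisymmetric Fock space with vacuum vector $\Omega$, creation operators $a(f)$, $a(f)x=f\wedge x$ (linear in $f\in\mathcal H$), and parity operator $\Gamma$ (acting as $(-1)^n$ on $n$-particle vectors). Let $q$ be an anti-unitary operator on $\mathcal H$ with $q^2=1$ and $qs_t=s_tq$ for all $t\ge 0$. Let $R\in\mathcal B(\mathcal H)$ satisfy $\epsilon\le R\le 1-\epsilon$ for some $\epsilon>0$ and $Rs_t=s_tR$ for all $t\ge0$, and suppose that there is an orthonormal basis $\{k_i\}$ of $\mathcal K$ with $R(g\otimes k_i)=\lambda_i\,(g\otimes k_i)$ for all $g\in L^2(0,\infty)$, where $\lambda_i\in[\epsilon,1-\epsilon]\setminus\{\tfrac12\}$. On $\mathcal H_R=\mathcal F_-(\mathcal H)\otimes\mathcal F_-(\mathcal H)$ put $$a_R(f)=a((1-R)^{1/2}f)\otimes\Gamma+1\otimes a(qR^{1/2}f)^*,\qquad f\in\mathcal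 H,$$ let $M_R=\{a_R(f),a_R(f)^*: f\in\mathcal H\}''$, and let $\alpha=\{\alpha_t\}_{t\ge0}$ be the CAR flow on $M_R$, i.e. the $E_0$-semigroup (a point-$\sigma$-weakly continuous semigroup of normal unital $*$-endomorphisms, preserving the vector state of $\Omega\otimes\Omega$) with $\alpha_t(a_R(f))=a_R(s_tf)$ for all $f\in\mathcal H$, $t\ge0$. Let $t\ge0$ and let $\{e_i\}_{i\in\mathcal P}$ be an orthonormal basis of $L^2(0,t)\otimes\mathcal K\subset\mathcal H$, with $\mathcal P$ linearly ordered. For a finite subset $I=\{i_1<\dots<i_n\}$ of $\mathcal P$ put $v_I=e_{i_1}\wedge\dots\wedge e_{i_n}$ and $qv_I=qe_{i_1}\wedge\dots\wedge qe_{i_n}$ (both equal to $\Omega$ if $I=\emptyset$). Then for every $T\in\alpha_t(M_R)'\cap M_R$, $$T(\Omega\otimes\Omega)\in\overline{\operatorname{span}}\{\,v_{I_1}\otimes qv_{I_2}: I_1,I_2\subset\mathcal P\ \text{finite},\ (-1)^{|I_1|}=(-1)^{|I_2|}\,\}.$$ -/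

import Mathlib

open scoped TensorProduct NNReal InnerProductSpace ComplexConjugate
open MeasureTheory

noncomputable section

namespace CAR

/-! ### Antisymmetric Fock space -/

section Fock

variable {H : Type*} [NormedAddCommGroup H] [InnerProductSpace ℂ H]

/-- Contraction `c(f)` of the exterior algebra by the functional `⟪f, ·⟫`: the antiderivation with
`c(f) g = ⟪f, g⟫` for `g ∈ H` and `c(f) 1 = 0`. -/
def contract (f : H) : ExteriorAlgebra ℂ H →ₗ[ℂ] ExteriorAlgebra ℂ H :=
  CliffordAlgebra.contractLeft (Q := (0 : QuadraticForm ℂ H)) (innerSL ℂ f : H →L[ℂ] ℂ).toLinearMap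

theorem contract_one (f : H) : contract f (1 : ExteriorAlgebra ℂ H) = 0 := by
  unfold contract; exact CliffordAlgebra.contractLeft_one (Q := (0 : QuadraticForm ℂ H)) _

theorem contract_algebraMap (f : H) (r : ℂ) :
    contract f (algebraMap ℂ (ExteriorAlgebra ℂ H) r) = 0 := by
  unfold contract; exact CliffordAlgebra.contractLeft_algebraMap (Q := (0 : QuadraticForm ℂ H)) _ _

theorem contract_ι_mul (f g : H) (x : ExteriorAlgebra ℂ H) :
    contract f (ExteriorAlgebra.ι ℂ g * x) =
      ⟪f, g⟫_ℂ • x - ExteriorAlgebra.ι ℂ g * contract f x := by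
  unfold contract; exact CliffordAlgebra.contractLeft_ι_mul (Q := (0 : QuadraticForm ℂ H)) _ _ _

theorem contract_contract (f : H) (x : ExteriorAlgebra ℂ H) : contract f (contract f x) = 0 := by
  unfold contract
  exact CliffordAlgebra.contractLeft_contractLeft (Q := (0 : QuadraticForm ℂ H))
    (d := (innerSL ℂ f : H →L[ℂ] ℂ).toLinearMap) x

theorem contract_add (f g : H) (x : ExteriorAlgebra ℂ H) :
    contract (f + g) x = contract f x + contract g x := by
  induction x using CliffordAlgebra.left_induction with
  | algebraMap r => simp [contract_algebraMap]
  | add x y hx hy => simp only [map_add, hx, hy]; abel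
  | ι_mul x m hx =>
    change contract (f + g) (ExteriorAlgebra.ι ℂ m * x) = contract f (ExteriorAlgebra.ι ℂ m * x) +
      contract g (ExteriorAlgebra.ι ℂ m * x)
    simp only [contract_ι_mul, hx, inner_add_left, add_smul, mul_add]; abel

theorem contract_smul (c : ℂ) (f : H) (x : ExteriorAlgebra ℂ H) :
    contract (c • f) x = conj c • contract f x := by
  induction x using CliffordAlgebra.left_induction with
  | algebraMap r => simp [contract_algebraMap]
  | add x y hx hy => simp only [map_add, hx, hy, smul_add]
  | ι_mul x m hx =>
    change contract (c • f) (ExteriorAlgebra.ι ℂ m * x) =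
      conj c • contract f (ExteriorAlgebra.ι ℂ m * x)
    simp only [contract_ι_mul, hx, inner_smul_left, smul_sub, mul_smul, mul_smul_comm]

/-- The sesquilinear form on the exterior algebra, with the linear argument first. It is determined
by `form 1 x = conj (ε x)`, with `ε` the projection to degree `0`, and
`form (f ∧ y) x = form y (c(f) x)`; see `form_ιMulti` for the Gram determinant formula. -/
def form : ExteriorAlgebra ℂ H →ₗ[ℂ] (ExteriorAlgebra ℂ H →ₗ⋆[ℂ] ℂ) :=
  CliffordAlgebra.foldr (0 : QuadraticForm ℂ H)
    (LinearMap.mk₂ ℂ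
      (fun (f : H) (φ : ExteriorAlgebra ℂ H →ₗ⋆[ℂ] ℂ) => φ.comp (contract f))
      (fun f g φ => by ext x; simp [contract_add])
      (fun c f φ => by ext x; simp [contract_smul])
      (fun f φ ψ => by ext x; simp)
      (fun c f φ => by ext x; simp))
    (fun f φ => by ext x; simp [contract_contract])
    ((starRingEnd ℂ).toSemilinearMap.comp (ExteriorAlgebra.algebraMapInv (M := H)).toLinearMap)

theorem form_algebraMap (r : ℂ) (x : ExteriorAlgebra ℂ H) :
    form (algebraMap ℂ (ExteriorAlgebra ℂ H) r) x =
      r * conj (ExteriorAlgebra.algebraMapInv x) := by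
  unfold form
  erw [CliffordAlgebra.foldr_algebraMap]
  simp

theorem form_smul_left (c : ℂ) (x y : ExteriorAlgebra ℂ H) :
    form (c • x) y = c * form x y := by
  rw [LinearMap.map_smul]; rfl

theorem form_smul_right (c : ℂ) (x y : ExteriorAlgebra ℂ H) :
    form x (c • y) = conj c * form x y := by
  rw [LinearMap.map_smulₛₗ]; rfl

theorem form_one (x : ExteriorAlgebra ℂ H) :
    form (1 : ExteriorAlgebra ℂ H) x = conj (ExteriorAlgebra.algebraMapInv x) := by
  simpa using form_algebraMap 1 x

theorem form_ι_mul (f : H) (x y : ExteriorAlgebra ℂ H) :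
    form (ExteriorAlgebra.ι ℂ f * y) x = form y (contract f x) := by
  unfold form
  erw [CliffordAlgebra.foldr_mul, CliffordAlgebra.foldr_ι]
  rfl

/-- Wedging with `f` and contracting with `f` are adjoint to each other. -/
theorem form_apply_ι_mul (f : H) (x y : ExteriorAlgebra ℂ H) :
    form y (ExteriorAlgebra.ι ℂ f * x) = form (contract f y) x := by
  induction y using CliffordAlgebra.left_induction generalizing x with
  | algebraMap r => rw [form_algebraMap, contract_algebraMap]; simp [ExteriorAlgebra.algebraMapInv]
  | add y z hy hz => simp only [map_add, LinearMap.add_apply, hy, hz]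
  | ι_mul y g hy =>
    change form (ExteriorAlgebra.ι ℂ g * y) _ = form (contract f (ExteriorAlgebra.ι ℂ g * y)) x
    rw [form_ι_mul, contract_ι_mul, contract_ι_mul]
    simp only [map_sub, LinearMap.sub_apply, map_smul, LinearMap.smul_apply, LinearMap.map_smulₛₗ,
      hy, form_ι_mul, smul_eq_mul, inner_conj_symm]

theorem conj_form (x y : ExteriorAlgebra ℂ H) : conj (form x y) = form y x := by
  induction y using CliffordAlgebra.left_induction generalizing x with
  | algebraMap r =>
    have h1 : ∀ x : ExteriorAlgebra ℂ H, form x 1 = ExteriorAlgebra.algebraMapInv x := by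
      intro x
      induction x using CliffordAlgebra.left_induction with
      | algebraMap r => rw [form_algebraMap]; simp [ExteriorAlgebra.algebraMapInv]
      | add y z hy hz => simp only [map_add, LinearMap.add_apply, hy, hz]
      | ι_mul y g hy =>
        change form (ExteriorAlgebra.ι ℂ g * y) _ =
          ExteriorAlgebra.algebraMapInv (ExteriorAlgebra.ι ℂ g * y)
        rw [form_ι_mul, contract_one]; simp [ExteriorAlgebra.algebraMapInv]
    rw [form_algebraMap, Algebra.algebraMap_eq_smul_one, LinearMap.map_smulₛₗ, h1]
    simp
  | add y z hy hz => simp only [map_add, LinearMap.add_apply, hy, hz]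
  | ι_mul y g hy =>
    change conj (form x (ExteriorAlgebra.ι ℂ g * y)) = form (ExteriorAlgebra.ι ℂ g * y) x
    rw [form_ι_mul, form_apply_ι_mul, hy]

/-- The subspace of the exterior algebra generated by a list of vectors. -/
def listSpan : List H → Submodule ℂ (ExteriorAlgebra ℂ H)
  | [] => Submodule.span ℂ {1}
  | e :: l => listSpan l ⊔ (listSpan l).map (LinearMap.mulLeft ℂ (ExteriorAlgebra.ι ℂ e))

theorem mem_listSpan_cons {e : H} {l : List H} {x : ExteriorAlgebra ℂ H} :
    x ∈ listSpan (e :: l) ↔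
      ∃ u ∈ listSpan l, ∃ w ∈ listSpan l, u + ExteriorAlgebra.ι ℂ e * w = x := by
  simp [listSpan, Submodule.mem_sup]

theorem one_mem_listSpan (l : List H) : (1 : ExteriorAlgebra ℂ H) ∈ listSpan l := by
  induction l with
  | nil => exact Submodule.mem_span_singleton_self _
  | cons e l ih => exact mem_listSpan_cons.2 ⟨1, ih, 0, zero_mem _, by simp⟩

theorem ι_mul_mem_listSpan (l : List H) (g : H) (hg : g ∈ Submodule.span ℂ {e | e ∈ l})
    (x : ExteriorAlgebra ℂ H) (hx : x ∈ listSpan l) :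
    ExteriorAlgebra.ι ℂ g * x ∈ listSpan l := by
  induction hg using Submodule.span_induction with
  | zero => simp
  | add f g _ _ hf hg => rw [map_add, add_mul]; exact add_mem hf hg
  | smul c f _ hf => rw [map_smul, smul_mul_assoc]; exact Submodule.smul_mem _ _ hf
  | mem g hg =>
    induction l generalizing x with
    | nil => simp at hg
    | cons e l ih =>
      obtain ⟨u, hu, w, hw, rfl⟩ := mem_listSpan_cons.1 hx
      rcases List.mem_cons.1 hg with rfl | hg
      · refine mem_listSpan_cons.2 ⟨0, zero_mem _, u, hu, ?_⟩
        rw [mul_add, ← mul_assoc, ExteriorAlgebra.ι_sq_zero]; simp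
      · refine mem_listSpan_cons.2 ⟨_, ih u hu hg, _, neg_mem (ih w hw hg), ?_⟩
        have h : ExteriorAlgebra.ι ℂ e * ExteriorAlgebra.ι ℂ g =
            -(ExteriorAlgebra.ι ℂ g * ExteriorAlgebra.ι ℂ e) :=
          eq_neg_of_add_eq_zero_left (ExteriorAlgebra.ι_add_mul_swap e g)
        rw [mul_add, mul_neg, ← mul_assoc, h, neg_mul, neg_neg, mul_assoc]

theorem contract_eq_zero_of_orthogonal (l : List H) (f : H) (hf : ∀ e ∈ l, ⟪f, e⟫_ℂ = 0)
    (x : ExteriorAlgebra ℂ H) (hx : x ∈ listSpan l) : contract f x = 0 := by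
  induction l generalizing x with
  | nil =>
    obtain ⟨c, rfl⟩ := Submodule.mem_span_singleton.1 hx
    rw [map_smul, contract_one, smul_zero]
  | cons e l ih =>
    obtain ⟨u, hu, w, hw, rfl⟩ := mem_listSpan_cons.1 hx
    have h := ih fun e he => hf e (List.mem_cons_of_mem _ he)
    rw [map_add, contract_ι_mul, h u hu, h w hw, hf e List.mem_cons_self]
    simp

theorem re_form_nonneg_of_mem (l : List H) (hl : l.Pairwise fun e f => ⟪e, f⟫_ℂ = 0)
    (x : ExteriorAlgebra ℂ H) (hx : x ∈ listSpan l) : 0 ≤ (form x x).re := by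
  induction l generalizing x with
  | nil =>
    obtain ⟨c, rfl⟩ := Submodule.mem_span_singleton.1 hx
    rw [form_smul_left, form_smul_right, form_one]
    simp only [map_one, mul_one, Complex.mul_conj]
    exact Complex.normSq_nonneg c
  | cons e l ih =>
    obtain ⟨u, hu, w, hw, rfl⟩ := mem_listSpan_cons.1 hx
    rw [List.pairwise_cons] at hl
    have hu' := contract_eq_zero_of_orthogonal l e hl.1 u hu
    have hw' := contract_eq_zero_of_orthogonal l e hl.1 w hw
    have h1 : form (u + ExteriorAlgebra.ι ℂ e * w) (u + ExteriorAlgebra.ι ℂ e * w) =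
        form u u + ⟪e, e⟫_ℂ * form w w := by
      simp only [map_add, LinearMap.add_apply, form_ι_mul, form_apply_ι_mul, hu', hw',
        contract_ι_mul, map_zero, LinearMap.zero_apply, mul_zero, sub_zero, form_smul_left,
        add_zero, zero_add]
    rw [h1, inner_self_eq_norm_sq_to_K, Complex.add_re]
    have h2 : (((‖e‖ : ℝ) : ℂ) ^ 2 * form w w).re = ‖e‖ ^ 2 * (form w w).re := by
      rw [← Complex.ofReal_pow, Complex.re_ofReal_mul]
    have h3 := ih hl.2 u hu
    have h4 := ih hl.2 w hw
    have h5 : (0 : ℝ) ≤ ‖e‖ ^ 2 * (form w w).re := by positivity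
    erw [h2]
    linarith

theorem exists_mem_listSpan (x : ExteriorAlgebra ℂ H) :
    ∃ W : Submodule ℂ H, FiniteDimensional ℂ W ∧
      ∀ l : List H, W ≤ Submodule.span ℂ {e | e ∈ l} → x ∈ listSpan l := by
  induction x using CliffordAlgebra.left_induction with
  | algebraMap r =>
    refine ⟨⊥, inferInstance, fun l _ => ?_⟩
    rw [Algebra.algebraMap_eq_smul_one]
    exact Submodule.smul_mem _ _ (one_mem_listSpan l)
  | add x y hx hy =>
    obtain ⟨V, hV, hx⟩ := hx
    obtain ⟨W, hW, hy⟩ := hy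
    exact ⟨V ⊔ W, inferInstance, fun l hl =>
      add_mem (hx l (le_sup_left.trans hl)) (hy l (le_sup_right.trans hl))⟩
  | ι_mul x m hx =>
    obtain ⟨V, hV, hx⟩ := hx
    exact ⟨V ⊔ Submodule.span ℂ {m}, inferInstance, fun l hl =>
      ι_mul_mem_listSpan l m
        (hl (Submodule.mem_sup_right (Submodule.mem_span_singleton_self m))) x
        (hx l (le_sup_left.trans hl))⟩

theorem re_form_nonneg (x : ExteriorAlgebra ℂ H) : 0 ≤ (form x x).re := by
  obtain ⟨W, hW, hx⟩ := exists_mem_listSpan x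
  let b := stdOrthonormalBasis ℂ W
  refine re_form_nonneg_of_mem (List.ofFn fun i => (b i : H)) ?_ x (hx _ ?_)
  · rw [List.pairwise_ofFn]
    intro i j hij
    have := b.orthonormal.2 hij.ne
    simpa using this
  · intro w hw
    have h : (⟨w, hw⟩ : W) ∈ Submodule.span ℂ (Set.range b) := by
      rw [← b.coe_toBasis, b.toBasis.span_eq]; trivial
    have := Submodule.mem_map_of_mem (f := W.subtype) h
    rw [Submodule.map_span, ← Set.range_comp] at this
    refine Submodule.span_mono ?_ this
    rintro _ ⟨i, rfl⟩
    simp [List.mem_ofFn]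

instance exteriorCore : PreInnerProductSpace.Core ℂ (ExteriorAlgebra ℂ H) where
  inner x y := form y x
  conj_inner_symm _ _ := conj_form _ _
  re_inner_nonneg x := re_form_nonneg x
  add_left _ _ _ := map_add _ _ _
  smul_left _ _ _ := LinearMap.map_smulₛₗ _ _ _

instance exteriorSeminormed : SeminormedAddCommGroup (ExteriorAlgebra ℂ H) :=
  InnerProductSpace.Core.toSeminormedAddCommGroup (𝕜 := ℂ)

instance exteriorInner : InnerProductSpace ℂ (ExteriorAlgebra ℂ H) :=
  InnerProductSpace.ofCore _

theorem inner_eq_form (x y : ExteriorAlgebra ℂ H) : ⟪x, y⟫_ℂ = form y x := rfl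

theorem ιMulti_succ (n : ℕ) (w : Fin (n + 1) → H) :
    ExteriorAlgebra.ιMulti ℂ (n + 1) w =
      ExteriorAlgebra.ι ℂ (w 0) * ExteriorAlgebra.ιMulti ℂ n (fun j => w j.succ) :=
  ExteriorAlgebra.ιMulti_succ_apply w

theorem contract_ιMulti (n : ℕ) (f : H) (w : Fin (n + 1) → H) :
    contract f (ExteriorAlgebra.ιMulti ℂ (n + 1) w) =
      ∑ i : Fin (n + 1), ((-1 : ℂ) ^ (i : ℕ) * ⟪f, w i⟫_ℂ) •
        ExteriorAlgebra.ιMulti ℂ n (fun j => w (i.succAbove j)) := by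
  induction n with
  | zero =>
    rw [ιMulti_succ, contract_ι_mul, ExteriorAlgebra.ιMulti_zero_apply, contract_one]
    simp
  | succ n ih =>
    rw [ιMulti_succ, contract_ι_mul, ih, sub_eq_add_neg]
    conv_rhs => rw [Fin.sum_univ_succ]
    congr 1
    · simp
    · rw [Finset.mul_sum, ← Finset.sum_neg_distrib]
      refine Finset.sum_congr rfl fun i _ => ?_
      rw [ιMulti_succ n fun j => w (i.succ.succAbove j), mul_smul_comm, ← neg_smul]
      simp only [Fin.val_succ, Fin.succ_succAbove_zero, Fin.succ_succAbove_succ]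
      congr 1
      ring

/-- The inner product of two wedge products is the Gram determinant. -/
theorem inner_ιMulti (n : ℕ) (v w : Fin n → H) :
    ⟪ExteriorAlgebra.ιMulti ℂ n v, ExteriorAlgebra.ιMulti ℂ n w⟫_ℂ =
      Matrix.det (Matrix.of fun i j => ⟪v i, w j⟫_ℂ) := by
  rw [inner_eq_form]
  induction n with
  | zero => simp [form_one]
  | succ n ih =>
    rw [ιMulti_succ n v, form_apply_ι_mul, contract_ιMulti, Matrix.det_succ_row_zero]
    simp only [map_sum, LinearMap.sum_apply, form_smul_left, ih]
    rfl

theorem norm_ι_mul_le (f : H) (x : ExteriorAlgebra ℂ H) :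
    ‖LinearMap.mulLeft ℂ (ExteriorAlgebra.ι ℂ f) x‖ ≤ ‖f‖ * ‖x‖ := by
  have h1 : ⟪ExteriorAlgebra.ι ℂ f * x, ExteriorAlgebra.ι ℂ f * x⟫_ℂ =
      ⟪f, f⟫_ℂ * ⟪x, x⟫_ℂ - ⟪contract f x, contract f x⟫_ℂ := by
    simp only [inner_eq_form]
    rw [form_apply_ι_mul, contract_ι_mul, map_sub, LinearMap.sub_apply, form_smul_left,
      form_ι_mul]
  have h2 : ‖ExteriorAlgebra.ι ℂ f * x‖ ^ 2 = ‖f‖ ^ 2 * ‖x‖ ^ 2 - ‖contract f x‖ ^ 2 := by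
    simp only [inner_self_eq_norm_sq_to_K] at h1
    exact_mod_cast h1
  rw [LinearMap.mulLeft_apply]
  refine abs_le_of_sq_le_sq' ?_ (by positivity) |>.2
  rw [h2, mul_pow]
  nlinarith [sq_nonneg ‖contract f x‖]

theorem contract_involute (f : H) (x : ExteriorAlgebra ℂ H) :
    contract f (CliffordAlgebra.involute x) = -CliffordAlgebra.involute (contract f x) := by
  induction x using CliffordAlgebra.left_induction with
  | algebraMap r => simp [contract_algebraMap]
  | add x y hx hy => simp only [map_add, hx, hy, neg_add]
  | ι_mul x m hx =>
    rw [map_mul, CliffordAlgebra.involute_ι, neg_mul, map_neg]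
    change -contract f (ExteriorAlgebra.ι ℂ m * _) =
      -CliffordAlgebra.involute (contract f (ExteriorAlgebra.ι ℂ m * x))
    rw [contract_ι_mul, contract_ι_mul, hx, map_sub, map_smul, map_mul]
    erw [CliffordAlgebra.involute_ι]
    simp

theorem form_involute (x y : ExteriorAlgebra ℂ H) :
    form (CliffordAlgebra.involute x) (CliffordAlgebra.involute y) = form x y := by
  induction x using CliffordAlgebra.left_induction generalizing y with
  | algebraMap r =>
    have h : ∀ y : ExteriorAlgebra ℂ H, ExteriorAlgebra.algebraMapInv (CliffordAlgebra.involute y) =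
        ExteriorAlgebra.algebraMapInv y := by
      intro y
      induction y using CliffordAlgebra.left_induction with
      | algebraMap r => simp
      | add x y hx hy => simp only [map_add, hx, hy]
      | ι_mul x m hx =>
        rw [map_mul, CliffordAlgebra.involute_ι, map_mul, map_mul, map_neg]
        change -ExteriorAlgebra.algebraMapInv (ExteriorAlgebra.ι ℂ m) * _ =
          ExteriorAlgebra.algebraMapInv (ExteriorAlgebra.ι ℂ m) * _
        simp [ExteriorAlgebra.algebraMapInv]
    rw [AlgHom.commutes]
    exact (form_algebraMap _ _).trans (by rw [h]; exact (form_algebraMap _ _).symm)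
  | add x z hx hz => simp only [map_add, LinearMap.add_apply, hx, hz]
  | ι_mul x m hx =>
    rw [map_mul, CliffordAlgebra.involute_ι, neg_mul, map_neg]
    change -form (ExteriorAlgebra.ι ℂ m * _) _ = form (ExteriorAlgebra.ι ℂ m * x) y
    rw [form_ι_mul, form_ι_mul, contract_involute, map_neg, neg_neg, hx]

theorem norm_involute (x : ExteriorAlgebra ℂ H) : ‖CliffordAlgebra.involute x‖ = ‖x‖ := by
  rw [← sq_eq_sq₀ (norm_nonneg _) (norm_nonneg _), @norm_sq_eq_re_inner ℂ, @norm_sq_eq_re_inner ℂ,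
    inner_eq_form, inner_eq_form, form_involute]

variable (H) in
/-- The antisymmetric Fock space `F₋(H)`: the Hilbert space completion of the exterior algebra of
`H` for the inner product given by Gram determinants. -/
def Fock : Type _ := UniformSpace.Completion (ExteriorAlgebra ℂ H)

instance : NormedAddCommGroup (Fock H) :=
  inferInstanceAs (NormedAddCommGroup (UniformSpace.Completion (ExteriorAlgebra ℂ H)))

instance : InnerProductSpace ℂ (Fock H) :=
  inferInstanceAs (InnerProductSpace ℂ (UniformSpace.Completion (ExteriorAlgebra ℂ H)))

instance : CompleteSpace (Fock H) :=
  inferInstanceAs (CompleteSpace (UniformSpace.Completion (ExteriorAlgebra ℂ H)))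

/-- The inclusion of the exterior algebra in Fock space. -/
def fockIncl : ExteriorAlgebra ℂ H →ₗᵢ[ℂ] Fock H :=
  UniformSpace.Completion.toComplₗᵢ (𝕜 := ℂ) (E := ExteriorAlgebra ℂ H)

/-- The wedge product `w₁ ∧ ⋯ ∧ wₙ` as a vector of Fock space. -/
def wedge (l : List H) : Fock H :=
  fockIncl (l.map (ExteriorAlgebra.ι ℂ)).prod

variable (H) in
/-- The vacuum vector `Ω`. -/
def vacuum : Fock H := wedge []

/-- The creation operator `a(f)`, `a(f) x = f ∧ x`. -/
def create (f : H) : Fock H →L[ℂ] Fock H :=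
  ((LinearMap.mulLeft ℂ (ExteriorAlgebra.ι ℂ f)).mkContinuous ‖f‖ (norm_ι_mul_le f)).completion

variable (H) in
/-- The parity operator `Γ`, acting as `(-1)ⁿ` on the `n`-particle space. -/
def parity : Fock H →L[ℂ] Fock H :=
  (((CliffordAlgebra.involute (Q := (0 : QuadraticForm ℂ H))).toLinearMap :
    ExteriorAlgebra ℂ H →ₗ[ℂ] ExteriorAlgebra ℂ H).mkContinuous 1
      (fun x => by rw [one_mul]; exact (norm_involute x).le)).completion

/-- The vector `w_I = w_{i₁} ∧ ⋯ ∧ w_{iₙ}` for `I = {i₁ < ⋯ < iₙ}`. -/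
def wedgeFamily {P : Type*} [LinearOrder P] (w : P → H) (I : Finset P) : Fock H :=
  wedge ((I.sort (· ≤ ·)).map w)

end Fock

/-! ### Hilbert space tensor products -/

section HTensor

variable {E F E' F' : Type*} [NormedAddCommGroup E] [InnerProductSpace ℂ E]
  [NormedAddCommGroup F] [InnerProductSpace ℂ F] [NormedAddCommGroup E'] [InnerProductSpace ℂ E']
  [NormedAddCommGroup F'] [InnerProductSpace ℂ F']

variable (E F) in
/-- The Hilbert space tensor product. -/
def HTensor : Type _ := UniformSpace.Completion (E ⊗[ℂ] F)

instance : NormedAddCommGroup (HTensor E F) :=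
  inferInstanceAs (NormedAddCommGroup (UniformSpace.Completion (E ⊗[ℂ] F)))

instance : InnerProductSpace ℂ (HTensor E F) :=
  inferInstanceAs (InnerProductSpace ℂ (UniformSpace.Completion (E ⊗[ℂ] F)))

instance : CompleteSpace (HTensor E F) :=
  inferInstanceAs (CompleteSpace (UniformSpace.Completion (E ⊗[ℂ] F)))

/-- The inclusion of the algebraic tensor product. -/
def htensorIncl : E ⊗[ℂ] F →ₗᵢ[ℂ] HTensor E F :=
  UniformSpace.Completion.toComplₗᵢ (𝕜 := ℂ) (E := E ⊗[ℂ] F)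

/-- Simple tensors. -/
def htmul (x : E) (y : F) : HTensor E F := htensorIncl (x ⊗ₜ[ℂ] y)

/-- The tensor product of two bounded operators, `(S ⊗ T)(x ⊗ y) = S x ⊗ T y`. -/
def hmap (S : E →L[ℂ] E') (T : F →L[ℂ] F') : HTensor E F →L[ℂ] HTensor E' F' :=
  (TensorProduct.mapL S T).completion

end HTensor

/-! ### The one-particle space and the shift semigroup -/

/-- `L²(s)` with respect to Lebesgue measure, for `s ⊆ ℝ`. -/
abbrev L2 (s : Set ℝ) : Type := Lp ℂ 2 (volume.restrict s)

/-- Extension by zero `L²(s) → L²(s')` for `s ⊆ s'`. -/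
def extendZero {s s' : Set ℝ} (hs : MeasurableSet s) (hss : s ⊆ s') : L2 s →ₗᵢ[ℂ] L2 s' :=
  have hr : (volume.restrict s').restrict s = (volume.restrict s : Measure ℝ) := by
    rw [Measure.restrict_restrict hs, Set.inter_eq_left.2 hss]
  have hm : ∀ f : L2 s, MemLp (s.indicator f) 2 (volume.restrict s') := fun f => by
    rw [memLp_indicator_iff_restrict hs, hr]; exact Lp.memLp f
  { toFun := fun f => (hm f).toLp _
    map_add' := fun f g => by
      rw [← MemLp.toLp_add]
      refine MemLp.toLp_congr _ _ ?_
      have h := Lp.coeFn_add f g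
      replace h := (show _ = _ from congrArg ae hr).le h
      filter_upwards [(ae_restrict_iff' hs).1 h] with x hx
      by_cases hxs : x ∈ s
      · simpa [hxs] using hx hxs
      · simp [hxs]
    map_smul' := fun c f => by
      rw [RingHom.id_apply, ← MemLp.toLp_const_smul]
      refine MemLp.toLp_congr _ _ ?_
      have h := Lp.coeFn_smul c f
      replace h := (show _ = _ from congrArg ae hr).le h
      filter_upwards [(ae_restrict_iff' hs).1 h] with x hx
      by_cases hxs : x ∈ s
      · simpa [hxs] using hx hxs
      · simp [hxs]
    norm_map' := fun f => by
      change ‖(hm f).toLp _‖ = _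
      rw [Lp.norm_toLp, eLpNorm_indicator_eq_eLpNorm_restrict hs, hr, Lp.norm_def] }

theorem measurePreserving_sub (t : ℝ≥0) :
    MeasurePreserving (fun x : ℝ => x - t) (volume.restrict (Set.Ioi (t : ℝ)))
      (volume.restrict (Set.Ioi (0 : ℝ))) := by
  have h := (measurePreserving_sub_right volume (t : ℝ)).restrict_preimage
    (measurableSet_Ioi (a := (0 : ℝ)))
  simpa using h

/-- The shift on `L²(0, ∞)`: `(s_t f)(x) = f(x - t)` for `x > t`, and `0` for `x ≤ t`. -/
def shiftL2 (t : ℝ≥0) : L2 (Set.Ioi 0) →ₗᵢ[ℂ] L2 (Set.Ioi 0) :=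
  (extendZero measurableSet_Ioi (Set.Ioi_subset_Ioi t.2)).comp
    (Lp.compMeasurePreservingₗᵢ ℂ (fun x : ℝ => x - t) (measurePreserving_sub t))

section OneParticle

variable (K : Type*) [NormedAddCommGroup K] [InnerProductSpace ℂ K]

/-- `L²(0, ∞) ⊗ K`. -/
abbrev OneParticle : Type _ := HTensor (L2 (Set.Ioi 0)) K

/-- The shift `s_t ⊗ 1` on `L²(0, ∞) ⊗ K`. -/
def shift (t : ℝ≥0) : OneParticle K →L[ℂ] OneParticle K :=
  hmap (shiftL2 t).toContinuousLinearMap (ContinuousLinearMap.id ℂ K)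

/-- `L²(0, t) ⊗ K`. -/
abbrev Past (t : ℝ≥0) : Type _ := HTensor (L2 (Set.Ioo 0 (t : ℝ))) K

/-- The inclusion of `L²(0, t) ⊗ K` in `L²(0, ∞) ⊗ K`. -/
def pastIncl (t : ℝ≥0) : Past K t →L[ℂ] OneParticle K :=
  hmap (extendZero measurableSet_Ioo Set.Ioo_subset_Ioi_self).toContinuousLinearMap
    (ContinuousLinearMap.id ℂ K)

end OneParticle

/-! ### Von Neumann algebras and `E₀`-semigroups -/

section VN

variable {X : Type*} [NormedAddCommGroup X] [InnerProductSpace ℂ X] [CompleteSpace X]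

/-- The bicommutant `A''` of a `*`-algebra `A` of bounded operators. -/
def bicommutant (A : StarSubalgebra ℂ (X →L[ℂ] X)) : VonNeumannAlgebra X where
  toStarSubalgebra :=
    { Subalgebra.centralizer ℂ (Set.centralizer (A : Set (X →L[ℂ] X))) with
      star_mem' := fun {x} hx => by
        have hx' : x ∈ Set.centralizer (Set.centralizer (A : Set (X →L[ℂ] X))) := hx
        exact Set.star_mem_centralizer' (fun a ha =>
          Set.star_mem_centralizer' (fun b hb => star_mem hb) ha) hx' }
  centralizer_centralizer' :=
    Set.centralizer_centralizer_centralizer (Set.centralizer (A : Set (X →L[ℂ] X)))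

theorem mem_bicommutant_of_mem {A : StarSubalgebra ℂ (X →L[ℂ] X)} {x : X →L[ℂ] X} (hx : x ∈ A) :
    x ∈ (bicommutant A).toStarSubalgebra :=
  Set.subset_centralizer_centralizer (S := (A : Set (X →L[ℂ] X))) hx

/-- `ρ` belongs to the predual of `M` (a normal functional): `ρ(x) = ∑ₙ ⟪ξₙ, x ηₙ⟫` with `∑ ‖ξₙ‖² < ∞` and `∑ ‖ηₙ‖² < ∞`. -/
def IsNormalFunctional (M : VonNeumannAlgebra X) (ρ : M.toStarSubalgebra → ℂ) : Prop :=
  ∃ ξ η : ℕ → X, Summable (fun n => ‖ξ n‖ ^ 2) ∧ Summable (fun n => ‖η n‖ ^ 2) ∧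
    ∀ x : M.toStarSubalgebra, HasSum (fun n => ⟪ξ n, (x : X →L[ℂ] X) (η n)⟫_ℂ) (ρ x)

/-- `α` is an `E₀`-semigroup on `M` preserving the vector state of `Φ`: a point-σ-weakly continuous
semigroup of normal unital `*`-endomorphisms. -/
structure IsE0Semigroup (M : VonNeumannAlgebra X) (Φ : X)
    (α : ℝ≥0 → (M.toStarSubalgebra →⋆ₐ[ℂ] M.toStarSubalgebra)) : Prop where
  normal : ∀ t (ρ : M.toStarSubalgebra → ℂ), IsNormalFunctional M ρ →
    IsNormalFunctional M (fun x => ρ (α t x))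
  preserves : ∀ t (x : M.toStarSubalgebra), ⟪Φ, (α t x : X →L[ℂ] X) Φ⟫_ℂ = ⟪Φ, (x : X →L[ℂ] X) Φ⟫_ℂ
  add : ∀ s t x, α s (α t x) = α (s + t) x
  zero : ∀ x, α 0 x = x
  continuous : ∀ x (ρ : M.toStarSubalgebra → ℂ), IsNormalFunctional M ρ →
    Continuous fun t => ρ (α t x)

end VN

/-! ### The quasi-free representation and the CAR flow -/

section Flow

variable {K : Type*} [NormedAddCommGroup K] [InnerProductSpace ℂ K]

variable (K) in
/-- `H_R = F₋(H) ⊗ F₋(H)` with `H = L²(0, ∞) ⊗ K`. -/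
abbrev GNS : Type _ := HTensor (Fock (OneParticle K)) (Fock (OneParticle K))

variable (K) in
/-- The cyclic vector `Ω ⊗ Ω`. -/
def cyclicVector : GNS K := htmul (vacuum _) (vacuum _)

variable (R : OneParticle K →L[ℂ] OneParticle K) (q : OneParticle K ≃ₗᵢ⋆[ℂ] OneParticle K)

/-- `a_R(f) = π_R(a(f)) = a((1 - R)^{1/2} f) ⊗ Γ + 1 ⊗ a(q R^{1/2} f)*`. -/
def carOp (f : OneParticle K) : GNS K →L[ℂ] GNS K :=
  hmap (create (CFC.sqrt (1 - R) f)) (parity _) +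
    hmap (ContinuousLinearMap.id ℂ _) (ContinuousLinearMap.adjoint (create (q (CFC.sqrt R f))))

/-- `π_R(𝒜)`, the unital `C*`-algebra generated by the operators `π_R(a(f))`. -/
def carImage : StarSubalgebra ℂ (GNS K →L[ℂ] GNS K) :=
  (StarAlgebra.adjoin ℂ (Set.range (carOp R q))).topologicalClosure

/-- `M_R = π_R(𝒜)''`. -/
def carFactor : VonNeumannAlgebra (GNS K) := bicommutant (carImage R q)

theorem carOp_mem (f : OneParticle K) : carOp R q f ∈ (carFactor R q).toStarSubalgebra :=
  mem_bicommutant_of_mem <| StarSubalgebra.le_topologicalClosure _ <|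
    StarAlgebra.subset_adjoin ℂ _ ⟨f, rfl⟩

/-- `α` is the CAR flow: the `E₀`-semigroup on `M_R` with `α_t(π_R(a(f))) = π_R(a(s_t f))`. -/
structure IsCARFlow
    (α : ℝ≥0 → ((carFactor R q).toStarSubalgebra →⋆ₐ[ℂ] (carFactor R q).toStarSubalgebra)) :
    Prop extends IsE0Semigroup (carFactor R q) (cyclicVector K) α where
  map_carOp : ∀ t f, (α t ⟨carOp R q f, carOp_mem R q f⟩ : GNS K →L[ℂ] GNS K) =
    carOp R q (shift K t f)

end Flow

end CAR

end

noncomputable section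

namespace CAR


/-! ### Hilbert space tensor products -/

section HTensor

variable {E F E' F' : Type*} [NormedAddCommGroup E] [InnerProductSpace ℂ E]
  [NormedAddCommGroup F] [InnerProductSpace ℂ F] [NormedAddCommGroup E'] [InnerProductSpace ℂ E']
  [NormedAddCommGroup F'] [InnerProductSpace ℂ F']

/-! Write `S` and `C` for the square roots of `R` and `1 - R`, let `G = Γ ⊗ Γ`, and let `ξ = T(Ω ⊗
Ω)`. The fields `d(f) = a(S f) ⊗ Γ - 1 ⊗ a(q C f)*` and their adjoints anticommute with the
quasi-free representation, so `d(f) G` and its adjoint lie in the commutant of `M_R` and hence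
commute with `T`. By the choice of `T`, it also commutes with `a_R(k)` and `a_R(k)*` for every `k`
in the range of `s_t`.

For such `k` the vectors `a_R(S k)(Ω ⊗ Ω)` and `d(C k) G (Ω ⊗ Ω)` coincide, and so do `a_R(C k)*(Ω ⊗
Ω)` and `G d(S k)*(Ω ⊗ Ω)`. Applying `T` and commuting it through gives two linear relations for `ξ`
(`relations_of_commute`).

The odd part of `ξ` vanishes. The first relation writes a creation operator `a(C S k) ⊗ Γ` on the
odd part as a difference of annihilation operators (`odd_part_relation`). Along a weakly null
sequence of `k`, obtained by iterating the unit shift on a wandering vector, annihilation operators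
tend strongly to zero, so the creation operators on the odd part do too. The CAR keep the sum of the
two squared norms equal to a fixed nonzero multiple of the squared norm of the odd part
(`eq_zero_of_odd_relations`).

Once `ξ` is even, the creation terms in both relations cancel, and `S² + C² = 1` leaves that `ξ` is
killed in both tensor factors by the annihilators of the range of `s_t` (`even_relations`). An even
vector with this property lives over the orthogonal complement `L²(0,t) ⊗ K`, which is the assertion
(`mem_closure_span_of_annihilated`). -/

theorem inner_htmul (x x' : E) (y y' : F) :
    ⟪htmul x y, htmul x' y'⟫_ℂ = ⟪x, x'⟫_ℂ * ⟪y, y'⟫_ℂ := by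
  unfold htmul
  rw [LinearIsometry.inner_map_map, TensorProduct.inner_tmul]

theorem norm_htmul (x : E) (y : F) : ‖htmul x y‖ = ‖x‖ * ‖y‖ := by
  unfold htmul
  rw [LinearIsometry.norm_map, TensorProduct.norm_tmul]

theorem hmap_htmul (S : E →L[ℂ] E') (T : F →L[ℂ] F') (x : E) (y : F) :
    hmap S T (htmul x y) = htmul (S x) (T y) :=
  ContinuousLinearMap.completion_apply_coe (TensorProduct.mapL S T) (x ⊗ₜ[ℂ] y)

variable (E F) in
/-- The bilinear map underlying simple tensors. -/
def htmulL : E →L[ℂ] F →L[ℂ] HTensor E F :=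
  LinearMap.mkContinuous₂ ((TensorProduct.mk ℂ E F).compr₂ htensorIncl.toLinearMap) 1
    (fun x y => by rw [one_mul]; exact (norm_htmul x y).le)

theorem htmulL_apply (x : E) (y : F) : htmulL E F x y = htmul x y := rfl

theorem htmul_neg_left (x : E) (y : F) : htmul (-x) y = -htmul x y := by
  rw [← htmulL_apply, map_neg]; rfl

theorem htmul_neg_right (x : E) (y : F) : htmul x (-y) = -htmul x y := by
  rw [← htmulL_apply, map_neg]; rfl

theorem htmul_zero_left (y : F) : htmul (0 : E) y = 0 := by
  rw [← htmulL_apply, map_zero]; rfl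

theorem htmul_zero_right (x : E) : htmul x (0 : F) = 0 := by
  rw [← htmulL_apply, map_zero]

/-- A closed subspace containing all tensors of members of two total sets is everything. -/
theorem htensor_mem_of_total {s : Set E} {s' : Set F}
    (hs : (Submodule.span ℂ s).topologicalClosure = ⊤)
    (hs' : (Submodule.span ℂ s').topologicalClosure = ⊤) (Z : Submodule ℂ (HTensor E F))
    (hZ : IsClosed (Z : Set (HTensor E F))) (h : ∀ x ∈ s, ∀ y ∈ s', htmul x y ∈ Z)
    (z : HTensor E F) : z ∈ Z := by
  have h1 : ∀ x ∈ s, ∀ y, htmul x y ∈ Z := by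
    intro x hx y
    have hc : IsClosed ((Z.comap (htmulL E F x).toLinearMap : Submodule ℂ F) : Set F) :=
      hZ.preimage (htmulL E F x).continuous
    have : (Submodule.span ℂ s').topologicalClosure ≤ Z.comap (htmulL E F x).toLinearMap :=
      Submodule.topologicalClosure_minimal _ (Submodule.span_le.2 fun y hy => h x hx y hy) hc
    exact this (hs' ▸ Submodule.mem_top)
  have h2 : ∀ x y, htmul x y ∈ Z := by
    intro x y
    have hc : IsClosed ((Z.comap ((htmulL E F).flip y).toLinearMap : Submodule ℂ E) : Set E) :=
      hZ.preimage ((htmulL E F).flip y).continuous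
    have : (Submodule.span ℂ s).topologicalClosure ≤ Z.comap ((htmulL E F).flip y).toLinearMap :=
      Submodule.topologicalClosure_minimal _ (Submodule.span_le.2 fun x hx => h1 x hx y) hc
    exact this (hs ▸ Submodule.mem_top)
  refine UniformSpace.Completion.induction_on (p := fun z : HTensor E F => z ∈ Z) z hZ ?_
  intro a
  change htensorIncl a ∈ Z
  induction a using TensorProduct.induction_on with
  | zero => rw [map_zero]; exact zero_mem _
  | tmul x y => exact h2 x y
  | add x y hx hy => rw [map_add]; exact add_mem hx hy

theorem span_univ_topologicalClosure (V : Type*) [NormedAddCommGroup V] [NormedSpace ℂ V] :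
    (Submodule.span ℂ (Set.univ : Set V)).topologicalClosure = ⊤ := by
  rw [Submodule.span_univ]
  exact top_le_iff.1 (Submodule.le_topologicalClosure _)

theorem htensor_mem (Z : Submodule ℂ (HTensor E F)) (hZ : IsClosed (Z : Set (HTensor E F)))
    (h : ∀ x y, htmul x y ∈ Z) (z : HTensor E F) : z ∈ Z := by
  exact htensor_mem_of_total (span_univ_topologicalClosure E)
    (span_univ_topologicalClosure F) Z hZ (fun x _ y _ => h x y) z

theorem htensor_ext_of_total {s : Set E} {s' : Set F}
    (hs : (Submodule.span ℂ s).topologicalClosure = ⊤)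
    (hs' : (Submodule.span ℂ s').topologicalClosure = ⊤) {V : Type*} [NormedAddCommGroup V]
    [InnerProductSpace ℂ V] {S T : HTensor E F →L[ℂ] V}
    (h : ∀ x ∈ s, ∀ y ∈ s', S (htmul x y) = T (htmul x y)) : S = T := by
  ext z
  exact htensor_mem_of_total hs hs' (LinearMap.eqLocus S.toLinearMap T.toLinearMap)
    (isClosed_eq S.continuous T.continuous) h z

theorem htensor_ext {V : Type*} [NormedAddCommGroup V] [InnerProductSpace ℂ V]
    {S T : HTensor E F →L[ℂ] V} (h : ∀ x y, S (htmul x y) = T (htmul x y)) : S = T := by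
  ext z
  exact htensor_mem (LinearMap.eqLocus S.toLinearMap T.toLinearMap)
    (isClosed_eq S.continuous T.continuous) h z

/-! ### Algebra and adjoints of product operators -/

theorem hmap_add_left (S S' : E →L[ℂ] E') (T : F →L[ℂ] F') :
    hmap (S + S') T = hmap S T + hmap S' T := by
  refine htensor_ext fun x y => ?_
  simp only [hmap_htmul, add_apply]
  simp only [← htmulL_apply, map_add, add_apply]

theorem hmap_add_right (S : E →L[ℂ] E') (T T' : F →L[ℂ] F') :
    hmap S (T + T') = hmap S T + hmap S T' := by
  refine htensor_ext fun x y => ?_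
  simp only [hmap_htmul, add_apply]
  simp only [← htmulL_apply, map_add]

theorem hmap_smul_left (c : ℂ) (S : E →L[ℂ] E') (T : F →L[ℂ] F') :
    hmap (c • S) T = c • hmap S T := by
  refine htensor_ext fun x y => ?_
  simp only [hmap_htmul, smul_apply]
  simp only [← htmulL_apply, map_smul, smul_apply]

theorem hmap_smul_right (c : ℂ) (S : E →L[ℂ] E') (T : F →L[ℂ] F') :
    hmap S (c • T) = c • hmap S T := by
  refine htensor_ext fun x y => ?_
  simp only [hmap_htmul, smul_apply]
  simp only [← htmulL_apply, map_smul]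

theorem hmap_neg_left (S : E →L[ℂ] E') (T : F →L[ℂ] F') : hmap (-S) T = -hmap S T := by
  simpa using hmap_smul_left (-1) S T

theorem hmap_neg_right (S : E →L[ℂ] E') (T : F →L[ℂ] F') : hmap S (-T) = -hmap S T := by
  simpa using hmap_smul_right (-1) S T

theorem hmap_one : hmap (1 : E →L[ℂ] E) (1 : F →L[ℂ] F) = 1 :=
  htensor_ext fun x y => by simp [hmap_htmul]

theorem hmap_mul (S S' : E →L[ℂ] E) (T T' : F →L[ℂ] F) :
    hmap S T * hmap S' T' = hmap (S * S') (T * T') :=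
  htensor_ext fun x y => by simp [hmap_htmul]

/-- The closed subspace `{v}ᗮ` contains a total set, hence `v` itself, so `⟪v, v⟫ = 0`. -/
theorem htensor_eq_zero_of_total {s : Set E} {s' : Set F}
    (hs : (Submodule.span ℂ s).topologicalClosure = ⊤)
    (hs' : (Submodule.span ℂ s').topologicalClosure = ⊤) {v : HTensor E F}
    (h : ∀ x ∈ s, ∀ y ∈ s', ⟪htmul x y, v⟫_ℂ = 0) : v = 0 := by
  have h1 : v ∈ (Submodule.span ℂ {v})ᗮ :=
    htensor_mem_of_total hs hs' _ (Submodule.isClosed_orthogonal _)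
      (fun x hx y hy => Submodule.mem_orthogonal_singleton_iff_inner_left.2 (h x hx y hy)) v
  exact inner_self_eq_zero.1 (Submodule.mem_orthogonal_singleton_iff_inner_left.1 h1)

theorem htensor_eq_zero {v : HTensor E F} (h : ∀ x y, ⟪htmul x y, v⟫_ℂ = 0) : v = 0 := by
  have h1 : v ∈ (Submodule.span ℂ {v})ᗮ :=
    htensor_mem _ (Submodule.isClosed_orthogonal _)
      (fun x y => Submodule.mem_orthogonal_singleton_iff_inner_left.2 (h x y)) v
  exact inner_self_eq_zero.1 (Submodule.mem_orthogonal_singleton_iff_inner_left.1 h1)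

theorem star_hmap [CompleteSpace E] [CompleteSpace F] (S : E →L[ℂ] E) (T : F →L[ℂ] F) :
    star (hmap S T) = hmap (star S) (star T) := by
  refine htensor_ext fun x y => ?_
  rw [← sub_eq_zero]
  refine htensor_eq_zero fun x' y' => ?_
  rw [inner_sub_right, ContinuousLinearMap.star_eq_adjoint,
    ContinuousLinearMap.adjoint_inner_right, hmap_htmul, hmap_htmul, inner_htmul, inner_htmul,
    ContinuousLinearMap.star_eq_adjoint, ContinuousLinearMap.star_eq_adjoint,
    ContinuousLinearMap.adjoint_inner_right, ContinuousLinearMap.adjoint_inner_right, sub_self]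

end HTensor


/-! ### Operators on Fock space -/

section Fock

variable {H : Type*} [NormedAddCommGroup H] [InnerProductSpace ℂ H]

theorem create_fockIncl (f : H) (x : ExteriorAlgebra ℂ H) :
    create f (fockIncl x) = fockIncl (ExteriorAlgebra.ι ℂ f * x) :=
  ContinuousLinearMap.completion_apply_coe _ x

theorem parity_fockIncl (x : ExteriorAlgebra ℂ H) :
    parity H (fockIncl x) = fockIncl (CliffordAlgebra.involute x) :=
  ContinuousLinearMap.completion_apply_coe _ x

theorem wedge_cons (f : H) (l : List H) : wedge (f :: l) = create f (wedge l) := by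
  rw [wedge, wedge, create_fockIncl, List.map_cons, List.prod_cons]

theorem fock_mem (Z : Submodule ℂ (Fock H)) (hZ : IsClosed (Z : Set (Fock H)))
    (h : ∀ x, fockIncl x ∈ Z) (z : Fock H) : z ∈ Z :=
  UniformSpace.Completion.induction_on (p := fun z : Fock H => z ∈ Z) z hZ h

theorem fock_ext {V : Type*} [NormedAddCommGroup V] [InnerProductSpace ℂ V]
    {S T : Fock H →L[ℂ] V} (h : ∀ x, S (fockIncl x) = T (fockIncl x)) : S = T := by
  ext z
  exact fock_mem (LinearMap.eqLocus S.toLinearMap T.toLinearMap)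
    (isClosed_eq S.continuous T.continuous) h z

/-- The annihilation operator acts on the exterior algebra by contraction. -/
theorem star_create_fockIncl (f : H) (x : ExteriorAlgebra ℂ H) :
    star (create f) (fockIncl x) = fockIncl (contract f x) := by
  rw [← sub_eq_zero, ← inner_self_eq_zero (𝕜 := ℂ)]
  set v := star (create f) (fockIncl x) - fockIncl (contract f x) with hv
  -- The difference `v` is orthogonal to the dense exterior algebra, because wedging and contraction
  -- are adjoint for the form; hence it is orthogonal to itself.
  have h1 : v ∈ (Submodule.span ℂ {v})ᗮ := by
    refine fock_mem _ (Submodule.isClosed_orthogonal _) (fun y => ?_) v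
    rw [Submodule.mem_orthogonal_singleton_iff_inner_left, hv, inner_sub_right,
      ContinuousLinearMap.star_eq_adjoint, ContinuousLinearMap.adjoint_inner_right,
      create_fockIncl, LinearIsometry.inner_map_map, LinearIsometry.inner_map_map,
      inner_eq_form, inner_eq_form, form_apply_ι_mul, sub_self]
  exact Submodule.mem_orthogonal_singleton_iff_inner_left.1 h1

theorem star_create_vacuum (f : H) : star (create f) (vacuum H) = 0 := by
  change star (create f) (fockIncl 1) = 0
  rw [star_create_fockIncl, contract_one, map_zero]

theorem parity_vacuum : parity H (vacuum H) = vacuum H := by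
  change parity H (fockIncl 1) = fockIncl 1
  rw [parity_fockIncl, map_one]

variable (H) in
theorem parity_mul_parity : parity H * parity H = 1 :=
  fock_ext fun x => by
    change parity H (parity H _) = _
    rw [parity_fockIncl, parity_fockIncl, CliffordAlgebra.involute_involute]
    rfl

variable (H) in
theorem star_parity : star (parity H) = parity H := by
  refine fock_ext fun x => ?_
  rw [← sub_eq_zero, ← inner_self_eq_zero (𝕜 := ℂ)]
  set v := star (parity H) (fockIncl x) - parity H (fockIncl x) with hv
  have h1 : v ∈ (Submodule.span ℂ {v})ᗮ := by
    refine fock_mem _ (Submodule.isClosed_orthogonal _) (fun y => ?_) v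
    rw [Submodule.mem_orthogonal_singleton_iff_inner_left, hv, inner_sub_right,
      ContinuousLinearMap.star_eq_adjoint, ContinuousLinearMap.adjoint_inner_right,
      parity_fockIncl, parity_fockIncl, LinearIsometry.inner_map_map,
      LinearIsometry.inner_map_map, inner_eq_form, inner_eq_form, sub_eq_zero,
      ← form_involute x, CliffordAlgebra.involute_involute]
  exact Submodule.mem_orthogonal_singleton_iff_inner_left.1 h1

theorem create_add (f g : H) : create (f + g) = create f + create g :=
  fock_ext fun x => by
    rw [add_apply, create_fockIncl, create_fockIncl, create_fockIncl, map_add, add_mul, map_add]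

theorem create_smul (c : ℂ) (f : H) : create (c • f) = c • create f :=
  fock_ext fun x => by
    rw [smul_apply, create_fockIncl, create_fockIncl, map_smul, smul_mul_assoc, map_smul]

theorem norm_create_le (f : H) : ‖create f‖ ≤ ‖f‖ := by
  refine ContinuousLinearMap.opNorm_le_bound _ (norm_nonneg _) fun z => ?_
  refine UniformSpace.Completion.induction_on
    (p := fun z : Fock H => ‖create f z‖ ≤ ‖f‖ * ‖z‖) z
    (isClosed_le (create f).continuous.norm (continuous_const.mul continuous_norm)) fun a => ?_
  change ‖create f (fockIncl a)‖ ≤ _ * ‖fockIncl a‖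
  rw [create_fockIncl, LinearIsometry.norm_map, LinearIsometry.norm_map]
  exact norm_ι_mul_le f a

variable (H) in
/-- The creation operator as a bounded linear function of the one-particle vector. -/
def createL : H →L[ℂ] Fock H →L[ℂ] Fock H :=
  LinearMap.mkContinuous
    { toFun := create
      map_add' := create_add
      map_smul' := create_smul } 1 (fun f => by rw [one_mul]; exact norm_create_le f)

theorem create_zero : create (0 : H) = 0 := map_zero (createL H)

theorem create_mul_create (f g : H) : create f * create g = -(create g * create f) :=
  fock_ext fun x => by
    change create f (create g _) = -create g (create f _)
    rw [create_fockIncl, create_fockIncl, create_fockIncl, create_fockIncl, ← map_neg, ← mul_assoc,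
      ← mul_assoc, eq_neg_of_add_eq_zero_left (ExteriorAlgebra.ι_add_mul_swap f g), neg_mul]

theorem create_mul_self (f : H) : create f * create f = 0 :=
  fock_ext fun x => by
    change create f (create f _) = 0
    rw [create_fockIncl, create_fockIncl, ← mul_assoc, ExteriorAlgebra.ι_sq_zero, zero_mul,
      map_zero]

/-- The canonical anticommutation relation. -/
theorem star_create_mul_create (f g : H) :
    star (create f) * create g = ⟪f, g⟫_ℂ • 1 - create g * star (create f) :=
  fock_ext fun x => by
    change star (create f) (create g _) = ⟪f, g⟫_ℂ • _ - create g (star (create f) _)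
    rw [create_fockIncl, star_create_fockIncl, star_create_fockIncl, create_fockIncl,
      contract_ι_mul, map_sub, map_smul]
    rfl

theorem parity_mul_create (f : H) : parity H * create f = -(create f * parity H) :=
  fock_ext fun x => by
    change parity H (create f _) = -create f (parity H _)
    rw [create_fockIncl, parity_fockIncl, parity_fockIncl, create_fockIncl, map_mul, ← map_neg]
    congr 1
    rw [← neg_mul]
    congr 1
    exact CliffordAlgebra.involute_ι _

variable (H) in
theorem span_wedge_topologicalClosure_eq_top :
    (Submodule.span ℂ (Set.range (wedge : List H → Fock H))).topologicalClosure = ⊤ := by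
  refine eq_top_iff.2 fun z _ => fock_mem _ (Submodule.isClosed_topologicalClosure _)
    (fun x => Submodule.le_topologicalClosure _ ?_) z
  induction x using CliffordAlgebra.left_induction with
  | algebraMap r =>
    rw [Algebra.algebraMap_eq_smul_one, map_smul]
    exact Submodule.smul_mem _ _ (Submodule.subset_span ⟨[], rfl⟩)
  | add x y hx hy => rw [map_add]; exact add_mem hx hy
  | ι_mul x m hx =>
    change fockIncl (ExteriorAlgebra.ι ℂ m * x) ∈ _
    rw [← create_fockIncl]
    refine (Submodule.span_le (p := (Submodule.span ℂ (Set.range (wedge : List H → Fock H))).comap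
      (create m).toLinearMap)).2 ?_ hx
    rintro _ ⟨l, rfl⟩
    exact Submodule.subset_span ⟨m :: l, wedge_cons m l⟩

/-! ### Wedges of lists, and reduction to ordered index sets -/

theorem wedge_perm {l l' : List H} (h : l.Perm l') : wedge l = wedge l' ∨ wedge l = -wedge l' := by
  induction h with
  | nil => exact Or.inl rfl
  | cons f _ ih =>
    rw [wedge_cons, wedge_cons]
    rcases ih with ih | ih <;> rw [ih]
    · exact Or.inl rfl
    · exact Or.inr (map_neg _ _)
  | swap f g l =>
    right
    rw [wedge_cons, wedge_cons, wedge_cons, wedge_cons]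
    exact DFunLike.congr_fun (create_mul_create g f) _
  | trans _ _ ih₁ ih₂ =>
    rcases ih₁ with h₁ | h₁ <;> rcases ih₂ with h₂ | h₂ <;> simp [h₁, h₂]

/-- A repeated factor can be moved, up to sign, next to its other occurrence, where `a(f)² = 0`
applies. -/
theorem wedge_map_eq_zero {P : Type*} (w : P → H) {l : List P} (h : ¬l.Nodup) :
    wedge (l.map w) = 0 := by
  classical
  induction l with
  | nil => simp at h
  | cons a l ih =>
    by_cases ha : a ∈ l
    · have h1 : wedge ((a :: l).map w) = create (w a) (wedge (l.map w)) := wedge_cons _ _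
      have h2 : create (w a) (wedge (w a :: (l.erase a).map w)) = 0 := by
        rw [wedge_cons]
        exact DFunLike.congr_fun (create_mul_self (w a)) _
      rcases wedge_perm ((List.perm_cons_erase ha).map w) with h3 | h3 <;> rw [h1, h3]
      · exact h2
      · rw [map_neg]; exact neg_eq_zero.2 h2
    · rw [List.map_cons, wedge_cons, ih fun hl => h (List.nodup_cons.2 ⟨ha, hl⟩), map_zero]

/-- Sorting costs a sign and repetitions give zero. This allows arbitrary lists as generators,
which, unlike sorted sets, are stable under prepending an index. -/
theorem wedge_map_mem_span {P : Type*} [LinearOrder P] (w : P → H) (l : List P) :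
    wedge (l.map w) ∈ Submodule.span ℂ (Set.range (wedgeFamily w)) := by
  by_cases h : l.Nodup
  · have h1 : l.Perm (l.toFinset.sort (· ≤ ·)) :=
      (List.perm_ext_iff_of_nodup h (Finset.sort_nodup _ _)).2 fun a => by simp
    have h2 : wedgeFamily w l.toFinset ∈ Submodule.span ℂ (Set.range (wedgeFamily w)) :=
      Submodule.subset_span ⟨_, rfl⟩
    rcases wedge_perm (h1.map w) with h3 | h3 <;> rw [h3]
    · exact h2
    · exact neg_mem h2
  · rw [wedge_map_eq_zero w h]; exact zero_mem _

theorem parity_wedge (l : List H) : parity H (wedge l) = (-1 : ℂ) ^ l.length • wedge l := by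
  induction l with
  | nil => rw [List.length_nil, pow_zero, one_smul]; exact parity_vacuum
  | cons f l ih =>
    rw [wedge_cons, List.length_cons, pow_succ, mul_smul, ← map_smul]
    change (parity H * create f) _ = _
    rw [parity_mul_create]
    change -create f (parity H _) = _
    rw [ih]
    simp

theorem parity_wedgeFamily {P : Type*} [LinearOrder P] (w : P → H) (I : Finset P) :
    parity H (wedgeFamily w I) = (-1 : ℂ) ^ I.card • wedgeFamily w I := by
  rw [wedgeFamily, parity_wedge, List.length_map, Finset.length_sort]

/-- The annihilator anticommutes past every factor, since all contractions vanish, and reaches the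
vacuum. -/
theorem star_create_wedge_eq_zero {f : H} {l : List H} (h : ∀ g ∈ l, ⟪f, g⟫_ℂ = 0) :
    star (create f) (wedge l) = 0 := by
  induction l with
  | nil => exact star_create_vacuum f
  | cons g l ih =>
    rw [wedge_cons]
    change (star (create f) * create g) _ = _
    rw [star_create_mul_create, h g List.mem_cons_self, zero_smul, zero_sub]
    change -create g (star (create f) _) = 0
    rw [ih fun g hg => h g (List.mem_cons_of_mem _ hg), map_zero, neg_zero]

theorem star_create_wedgeFamily_eq_zero {P : Type*} [LinearOrder P] {w : P → H} {f : H}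
    (h : ∀ i, ⟪f, w i⟫_ℂ = 0) (I : Finset P) : star (create f) (wedgeFamily w I) = 0 := by
  refine star_create_wedge_eq_zero fun g hg => ?_
  obtain ⟨i, _, rfl⟩ := List.mem_map.1 hg
  exact h i

/-- If `w` and `V` span `H`, then the vectors `w_I` and `f ∧ x`, with `f ∈ V`, are total in Fock
space. -/
theorem span_wedgeFamily_union_topologicalClosure_eq_top {P : Type*} [LinearOrder P] (w : P → H)
    (V : Set H) (hV : (Submodule.span ℂ (Set.range w ∪ V)).topologicalClosure = ⊤) :
    (Submodule.span ℂ (Set.range (wedgeFamily w) ∪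
      {y | ∃ f ∈ V, ∃ x, y = create f x})).topologicalClosure = ⊤ := by
  set Z := Submodule.span ℂ (Set.range (wedgeFamily w) ∪ {y | ∃ f ∈ V, ∃ x, y = create f x})
  have hZ : IsClosed (Z.topologicalClosure : Set (Fock H)) :=
    Submodule.isClosed_topologicalClosure _
  have hlist : ∀ l : List P, wedge (l.map w) ∈ Z := fun l =>
    Submodule.span_mono Set.subset_union_left (wedge_map_mem_span w l)
  -- Generators indexed by lists rather than finite sets make the action of `create (w i)` a mere
  -- prepending.
  have hZ' : Z ≤ Submodule.span ℂ (Set.range (fun l : List P => wedge (l.map w)) ∪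
      {y | ∃ f ∈ V, ∃ x, y = create f x}) := by
    refine Submodule.span_mono (Set.union_subset_union_left _ ?_)
    rintro _ ⟨I, rfl⟩
    exact ⟨I.sort (· ≤ ·), rfl⟩
  have h1 : ∀ f ∈ Set.range w ∪ V, ∀ y ∈ Z, create f y ∈ Z := by
    intro f hf y hy
    rcases hf with ⟨i, rfl⟩ | hf
    · refine (Submodule.span_le (p := Z.comap (create (w i)).toLinearMap)).2 ?_ (hZ' hy)
      rintro _ (⟨l, rfl⟩ | ⟨f, hf, x, rfl⟩)
      · have := hlist (i :: l)
        rw [List.map_cons, wedge_cons] at this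
        exact this
      · change (create (w i) * create f) x ∈ Z
        rw [create_mul_create]
        exact neg_mem (Submodule.subset_span (Or.inr ⟨f, hf, create (w i) x, rfl⟩))
    · exact Submodule.subset_span (Or.inr ⟨f, hf, y, rfl⟩)
  -- Creation is continuous separately in the one-particle vector and in the Fock vector, so
  -- invariance passes from the spanning set and `Z` to all `f` and the closure of `Z`.
  have h2 : ∀ f, ∀ y ∈ Z.topologicalClosure, create f y ∈ Z.topologicalClosure := by
    intro f y hy
    have hc : IsClosed ((Z.topologicalClosure.comap
        ((createL H).flip y).toLinearMap : Submodule ℂ H) : Set H) :=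
      hZ.preimage ((createL H).flip y).continuous
    have : (Submodule.span ℂ (Set.range w ∪ V)).topologicalClosure ≤
        Z.topologicalClosure.comap ((createL H).flip y).toLinearMap := by
      refine Submodule.topologicalClosure_minimal _ (Submodule.span_le.2 fun f hf => ?_) hc
      have hc' : IsClosed ((Z.topologicalClosure.comap (create f).toLinearMap :
          Submodule ℂ (Fock H)) : Set (Fock H)) := hZ.preimage (create f).continuous
      have hle : Z ≤ Z.topologicalClosure.comap (create f).toLinearMap := fun z hz =>
        Submodule.le_topologicalClosure Z (h1 f hf z hz)
      exact Submodule.topologicalClosure_minimal Z hle hc' hy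
    exact this (hV ▸ Submodule.mem_top)
  refine top_le_iff.1 ?_
  rw [← span_wedge_topologicalClosure_eq_top H]
  refine Submodule.topologicalClosure_minimal _ (Submodule.span_le.2 ?_) hZ
  rintro _ ⟨l, rfl⟩
  induction l with
  | nil => exact Submodule.le_topologicalClosure _ (hlist [])
  | cons f l ih => rw [wedge_cons]; exact h2 f _ ih

/-- Annihilation operators of a weakly null sequence tend to zero strongly. -/
theorem tendsto_star_create {f : ℕ → H}
    (hf : ∀ g, Filter.Tendsto (fun n => ⟪f n, g⟫_ℂ) Filter.atTop (nhds 0)) (l : List H) :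
    Filter.Tendsto (fun n => star (create (f n)) (wedge l)) Filter.atTop (nhds 0) := by
  induction l with
  | nil =>
    have : ∀ n, star (create (f n)) (wedge []) = 0 := fun n => star_create_vacuum (f n)
    simp [this]
  | cons g l ih =>
    have h1 : ∀ n, star (create (f n)) (wedge (g :: l)) =
        ⟪f n, g⟫_ℂ • wedge l - create g (star (create (f n)) (wedge l)) := fun n => by
      rw [wedge_cons]
      exact DFunLike.congr_fun (star_create_mul_create (f n) g) _
    simp only [h1]
    simpa using ((hf g).smul_const (wedge l)).sub
      (((create g).continuous.tendsto 0).comp ih)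

end Fock


/-! ### The shift semigroup -/

section Shift

theorem coeFn_extendZero {s s' : Set ℝ} (hs : MeasurableSet s) (hss : s ⊆ s') (f : L2 s) :
    extendZero hs hss f =ᵐ[volume.restrict s'] s.indicator f :=
  MemLp.coeFn_toLp (by
    rw [memLp_indicator_iff_restrict hs, Measure.restrict_restrict hs, Set.inter_eq_left.2 hss]
    exact Lp.memLp f)

theorem inner_extendZero_of_disjoint {s₁ s₂ s' : Set ℝ} (hs₁ : MeasurableSet s₁)
    (hs₂ : MeasurableSet s₂) (hss₁ : s₁ ⊆ s') (hss₂ : s₂ ⊆ s') (hd : Disjoint s₁ s₂) (f : L2 s₁)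
    (g : L2 s₂) : ⟪extendZero hs₁ hss₁ f, extendZero hs₂ hss₂ g⟫_ℂ = 0 := by
  rw [L2.inner_def]
  refine integral_eq_zero_of_ae ?_
  filter_upwards [coeFn_extendZero hs₁ hss₁ f, coeFn_extendZero hs₂ hss₂ g] with x h1 h2
  rw [h1, h2]
  by_cases hx : x ∈ s₁
  · simp [Set.indicator_of_notMem (Set.disjoint_left.1 hd hx)]
  · simp [Set.indicator_of_notMem hx]

theorem inner_extendZero_shiftL2 (t : ℝ≥0) (f : L2 (Set.Ioo 0 (t : ℝ))) (g : L2 (Set.Ioi 0)) :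
    ⟪extendZero measurableSet_Ioo Set.Ioo_subset_Ioi_self f, shiftL2 t g⟫_ℂ = 0 :=
  inner_extendZero_of_disjoint measurableSet_Ioo measurableSet_Ioi Set.Ioo_subset_Ioi_self
    (Set.Ioi_subset_Ioi t.2) (Set.disjoint_left.2 fun _ hx hx' => lt_asymm hx.2 hx') f
    (Lp.compMeasurePreservingₗᵢ ℂ (fun x : ℝ => x - t) (measurePreserving_sub t) g)

/-- Translation by `t` in the opposite direction supplies a preimage. Consequently every function
supported on `(t, ∞)` is a shift. -/
theorem surjective_compMeasurePreserving_sub (t : ℝ≥0) :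
    Function.Surjective (Lp.compMeasurePreservingₗᵢ ℂ (fun x : ℝ => x - t)
      (measurePreserving_sub t) : L2 (Set.Ioi 0) → L2 (Set.Ioi (t : ℝ))) := by
  intro f
  have hp : MeasurePreserving (fun x : ℝ => x + t) (volume.restrict (Set.Ioi (0 : ℝ)))
      (volume.restrict (Set.Ioi (t : ℝ))) := by
    have h := (measurePreserving_add_right volume (t : ℝ)).restrict_preimage
      (measurableSet_Ioi (a := (t : ℝ)))
    simpa using h
  have hf := Lp.memLp f
  refine ⟨(hf.comp_measurePreserving hp).toLp _, ?_⟩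
  have h1 := Lp.toLp_compMeasurePreserving (hf.comp_measurePreserving hp) (measurePreserving_sub t)
  refine h1.trans ((MemLp.toLp_congr _ hf ?_).trans (Lp.toLp_coeFn f hf))
  refine Filter.Eventually.of_forall fun x => ?_
  simp

theorem exists_eq_extendZero_add_shiftL2 (t : ℝ≥0) (f : L2 (Set.Ioi 0)) :
    ∃ (g : L2 (Set.Ioo 0 (t : ℝ))) (h : L2 (Set.Ioi 0)),
      f = extendZero measurableSet_Ioo Set.Ioo_subset_Ioi_self g + shiftL2 t h := by
  have hr : ∀ {s : Set ℝ}, s ⊆ Set.Ioi 0 → MemLp f 2 (volume.restrict s) := fun hs =>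
    (Lp.memLp f).mono_measure (Measure.restrict_mono hs le_rfl)
  have ht : Set.Ioi (t : ℝ) ⊆ Set.Ioi 0 := Set.Ioi_subset_Ioi t.2
  have h0 : Set.Ioo 0 (t : ℝ) ⊆ Set.Ioi 0 := Set.Ioo_subset_Ioi_self
  obtain ⟨h, hh⟩ := surjective_compMeasurePreserving_sub t ((hr ht).toLp _)
  refine ⟨(hr h0).toLp _, h, ?_⟩
  have h2 : shiftL2 t h = extendZero measurableSet_Ioi ht ((hr ht).toLp _) :=
    congrArg (extendZero measurableSet_Ioi ht) hh
  rw [h2]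
  refine Lp.ext ?_
  have hae : ∀ {s : Set ℝ} (hs : MeasurableSet s) (hss : s ⊆ Set.Ioi 0),
      extendZero hs hss ((hr hss).toLp _) =ᵐ[volume.restrict (Set.Ioi 0)] s.indicator f := by
    intro s hs hss
    have hm : (volume.restrict (Set.Ioi (0 : ℝ))).restrict s = volume.restrict s := by
      rw [Measure.restrict_restrict hs, Set.inter_eq_left.2 hss]
    have h3 := MemLp.coeFn_toLp (hr hss)
    replace h3 := (show _ = _ from congrArg ae hm).le h3
    filter_upwards [coeFn_extendZero hs hss ((hr hss).toLp _), (ae_restrict_iff' hs).1 h3]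
      with x h4 h5
    rw [h4]
    by_cases hx : x ∈ s
    · rw [Set.indicator_of_mem hx, Set.indicator_of_mem hx, h5 hx]
    · rw [Set.indicator_of_notMem hx, Set.indicator_of_notMem hx]
  -- The intervals `(0, t)` and `(t, ∞)` miss only the null point `t`.
  have hne : ∀ᵐ x ∂(volume.restrict (Set.Ioi (0 : ℝ))), x ≠ (t : ℝ) :=
    ae_restrict_of_ae (Measure.ae_ne volume (t : ℝ))
  filter_upwards [Lp.coeFn_add (extendZero measurableSet_Ioo h0 ((hr h0).toLp _))
    (extendZero measurableSet_Ioi ht ((hr ht).toLp _)), hae measurableSet_Ioo h0,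
    hae measurableSet_Ioi ht, hne, ae_restrict_mem measurableSet_Ioi] with x h3 h4 h5 h6 h7
  rw [h3, Pi.add_apply, h4, h5]
  rcases lt_or_gt_of_ne h6 with hx | hx
  · rw [Set.indicator_of_mem (show x ∈ Set.Ioo 0 (t : ℝ) from ⟨h7, hx⟩),
      Set.indicator_of_notMem (show x ∉ Set.Ioi (t : ℝ) from not_lt.2 hx.le), add_zero]
  · rw [Set.indicator_of_notMem (show x ∉ Set.Ioo 0 (t : ℝ) from fun h => lt_asymm h.2 hx),
      Set.indicator_of_mem (show x ∈ Set.Ioi (t : ℝ) from hx), zero_add]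

variable {K : Type*} [NormedAddCommGroup K] [InnerProductSpace ℂ K]

theorem shift_htmul (t : ℝ≥0) (g : L2 (Set.Ioi 0)) (k : K) :
    shift K t (htmul g k) = htmul (shiftL2 t g) k := hmap_htmul _ _ _ _

theorem pastIncl_htmul (t : ℝ≥0) (g : L2 (Set.Ioo 0 (t : ℝ))) (k : K) :
    pastIncl K t (htmul g k) =
      htmul (extendZero measurableSet_Ioo Set.Ioo_subset_Ioi_self g) k := hmap_htmul _ _ _ _

theorem inner_pastIncl_shift (t : ℝ≥0) (x : Past K t) (y : OneParticle K) :
    ⟪pastIncl K t x, shift K t y⟫_ℂ = 0 := by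
  have h1 : ∀ g k, shift K t y ∈ (Submodule.span ℂ {pastIncl K t (htmul g k)})ᗮ := by
    intro g k
    have hc : IsClosed (((Submodule.span ℂ {pastIncl K t (htmul g k)})ᗮ.comap
        (shift K t).toLinearMap : Submodule ℂ (OneParticle K)) : Set (OneParticle K)) :=
      (Submodule.isClosed_orthogonal _).preimage (shift K t).continuous
    refine htensor_mem _ hc (fun g' k' => ?_) y
    rw [Submodule.mem_comap, Submodule.mem_orthogonal_singleton_iff_inner_right]
    change ⟪_, shift K t (htmul g' k')⟫_ℂ = 0
    rw [pastIncl_htmul, shift_htmul, inner_htmul, inner_extendZero_shiftL2, zero_mul]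
  have hc : IsClosed (((Submodule.span ℂ {shift K t y})ᗮ.comap
      (pastIncl K t).toLinearMap : Submodule ℂ (Past K t)) : Set (Past K t)) :=
    (Submodule.isClosed_orthogonal _).preimage (pastIncl K t).continuous
  have h2 := htensor_mem _ hc (fun g k => ?_) x
  · exact Submodule.mem_orthogonal_singleton_iff_inner_left.1 h2
  · exact Submodule.mem_orthogonal_singleton_iff_inner_left.2
      (Submodule.mem_orthogonal_singleton_iff_inner_right.1 (h1 g k))

theorem norm_shift (t : ℝ≥0) (x : OneParticle K) : ‖shift K t x‖ = ‖x‖ := by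
  refine UniformSpace.Completion.induction_on
    (p := fun x : OneParticle K => ‖shift K t x‖ = ‖x‖) x
    (isClosed_eq (shift K t).continuous.norm continuous_norm) fun a => ?_
  have h1 : shift K t (htensorIncl a) =
      htensorIncl (TensorProduct.mapL (shiftL2 t).toContinuousLinearMap
        (ContinuousLinearMap.id ℂ K) a) :=
    ContinuousLinearMap.completion_apply_coe (TensorProduct.mapL _ _) a
  change ‖shift K t (htensorIncl a)‖ = ‖htensorIncl a‖
  rw [h1, LinearIsometry.norm_map, LinearIsometry.norm_map, TensorProduct.mapL_apply]
  exact TensorProduct.norm_map (shiftL2 t) (LinearIsometry.id) a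

variable (K) in
/-- The shift as a linear isometry. -/
def shiftₗᵢ (t : ℝ≥0) : OneParticle K →ₗᵢ[ℂ] OneParticle K :=
  { (shift K t).toLinearMap with norm_map' := norm_shift t }

theorem inner_shift_shift (t : ℝ≥0) (x y : OneParticle K) :
    ⟪shift K t x, shift K t y⟫_ℂ = ⟪x, y⟫_ℂ :=
  (shiftₗᵢ K t).inner_map_map x y

/-- `L²(0, ∞) ⊗ K` is spanned by `L²(0, t) ⊗ K` and the range of the shift by `t`. -/
theorem span_pastIncl_union_range_shift (t : ℝ≥0) {P : Type*} (e : P → Past K t)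
    (he : (Submodule.span ℂ (Set.range e)).topologicalClosure = ⊤) :
    (Submodule.span ℂ (Set.range (fun i => pastIncl K t (e i)) ∪
      Set.range (shift K t))).topologicalClosure = ⊤ := by
  set Z := Submodule.span ℂ (Set.range (fun i => pastIncl K t (e i)) ∪ Set.range (shift K t))
  have hZ : IsClosed (Z.topologicalClosure : Set (OneParticle K)) :=
    Submodule.isClosed_topologicalClosure _
  have h1 : ∀ x, pastIncl K t x ∈ Z.topologicalClosure := by
    intro x
    have hc : IsClosed ((Z.topologicalClosure.comap (pastIncl K t).toLinearMap :
        Submodule ℂ (Past K t)) : Set (Past K t)) := hZ.preimage (pastIncl K t).continuous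
    have hle : Submodule.span ℂ (Set.range e) ≤
        Z.topologicalClosure.comap (pastIncl K t).toLinearMap := by
      refine Submodule.span_le.2 ?_
      rintro _ ⟨i, rfl⟩
      exact Submodule.le_topologicalClosure _ (Submodule.subset_span (Or.inl ⟨i, rfl⟩))
    exact Submodule.topologicalClosure_minimal _ hle hc (he ▸ Submodule.mem_top)
  refine eq_top_iff.2 fun z _ => htensor_mem _ hZ (fun f k => ?_) z
  obtain ⟨g, h, rfl⟩ := exists_eq_extendZero_add_shiftL2 t f
  rw [← htmulL_apply, map_add, add_apply, htmulL_apply, htmulL_apply, ← pastIncl_htmul,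
    ← shift_htmul]
  exact add_mem (h1 _) (Submodule.le_topologicalClosure _ (Submodule.subset_span (Or.inr ⟨_, rfl⟩)))

/-- A unit vector orthogonal to the range of the unit shift. -/
theorem exists_norm_eq_one_orthogonal_shift_one [Nontrivial K] :
    ∃ u : OneParticle K, ‖u‖ = 1 ∧ ∀ y, ⟪u, shift K 1 y⟫_ℂ = 0 := by
  obtain ⟨k, hk⟩ := exists_norm_eq K zero_le_one
  have hfin : volume.restrict (Set.Ioo 0 ((1 : ℝ≥0) : ℝ)) Set.univ ≠ ⊤ := by simp
  -- The constant function `1` on `(0, 1)` has norm one and is supported off the range of the unit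
  -- shift.
  let g : L2 (Set.Ioo 0 ((1 : ℝ≥0) : ℝ)) :=
    indicatorConstLp 2 MeasurableSet.univ hfin (1 : ℂ)
  refine ⟨pastIncl K 1 (htmul g k), ?_, inner_pastIncl_shift 1 _⟩
  rw [pastIncl_htmul, norm_htmul, LinearIsometry.norm_map, hk, mul_one,
    norm_indicatorConstLp (by simp) (by simp)]
  simp [Measure.real]

/-- The vector `u` is wandering: since the shift is an isometry, the orbit of `u` is orthonormal,
and Bessel's inequality makes its coefficients square summable. -/
theorem tendsto_inner_shift_pow {u : OneParticle K} (hu : ‖u‖ = 1)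
    (h : ∀ y, ⟪u, shift K 1 y⟫_ℂ = 0) (y : OneParticle K) :
    Filter.Tendsto (fun n => ⟪(shift K 1)^[n] u, y⟫_ℂ) Filter.atTop (nhds 0) := by
  have hn : ∀ n, ‖(shift K 1)^[n] u‖ = 1 := by
    intro n
    induction n with
    | zero => exact hu
    | succ n ih => rw [Function.iterate_succ_apply', norm_shift, ih]
  have hlt : ∀ n m, n < m → ⟪(shift K 1)^[n] u, (shift K 1)^[m] u⟫_ℂ = 0 := by
    intro n
    induction n with
    | zero =>
      intro m hm
      obtain ⟨m, rfl⟩ := Nat.exists_eq_succ_of_ne_zero hm.ne'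
      rw [Function.iterate_succ_apply']
      exact h _
    | succ n ih =>
      intro m hm
      obtain ⟨m, rfl⟩ := Nat.exists_eq_succ_of_ne_zero (Nat.ne_zero_of_lt hm)
      rw [Function.iterate_succ_apply', Function.iterate_succ_apply', inner_shift_shift]
      exact ih m (Nat.lt_of_succ_lt_succ hm)
  have ho : Orthonormal ℂ (fun n => (shift K 1)^[n] u) := by
    refine ⟨hn, fun n m hnm => ?_⟩
    rcases lt_or_gt_of_ne hnm with h1 | h1
    · exact hlt n m h1
    · change ⟪(shift K 1)^[n] u, (shift K 1)^[m] u⟫_ℂ = 0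
      rw [← inner_conj_symm, hlt m n h1, map_zero]
  have h1 := (ho.inner_products_summable y).tendsto_atTop_zero
  rw [tendsto_zero_iff_norm_tendsto_zero]
  have h2 := h1.sqrt
  simpa using h2

end Shift


/-! ### Two copies of the creation operators -/

section DoubleFock

variable {H : Type*} [NormedAddCommGroup H] [InnerProductSpace ℂ H]

/-- The creation operator `a(f) ⊗ Γ` in the first factor, twisted by the parity. -/
def createFst (f : H) : HTensor (Fock H) (Fock H) →L[ℂ] HTensor (Fock H) (Fock H) :=
  hmap (create f) (parity H)

/-- The creation operator `1 ⊗ a(f)` in the second factor. -/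
def createSnd (f : H) : HTensor (Fock H) (Fock H) →L[ℂ] HTensor (Fock H) (Fock H) :=
  hmap 1 (create f)

variable (H) in
/-- The total parity `Γ ⊗ Γ`. -/
def doubleParity : HTensor (Fock H) (Fock H) →L[ℂ] HTensor (Fock H) (Fock H) :=
  hmap (parity H) (parity H)

variable (H) in
/-- The vector `Ω ⊗ Ω`. -/
def doubleVacuum : HTensor (Fock H) (Fock H) := htmul (vacuum H) (vacuum H)

theorem star_createFst_eq (f : H) : star (createFst f) = hmap (star (create f)) (parity H) := by
  rw [createFst, star_hmap, star_parity]

theorem star_createSnd_eq (f : H) : star (createSnd f) = hmap 1 (star (create f)) := by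
  rw [createSnd, star_hmap, star_one]

theorem createFst_add (f g : H) : createFst (f + g) = createFst f + createFst g := by
  rw [createFst, create_add, hmap_add_left]; rfl

theorem createSnd_add (f g : H) : createSnd (f + g) = createSnd f + createSnd g := by
  rw [createSnd, create_add, hmap_add_right]; rfl

theorem createFst_anticomm (f g : H) : createFst f * createFst g = -(createFst g * createFst f) := by
  simp only [createFst, hmap_mul]
  rw [create_mul_create, hmap_neg_left]

theorem createSnd_anticomm (f g : H) : createSnd f * createSnd g = -(createSnd g * createSnd f) := by
  simp only [createSnd, hmap_mul]
  rw [create_mul_create, hmap_neg_right]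

theorem star_createFst_mul (f g : H) :
    star (createFst f) * createFst g = ⟪f, g⟫_ℂ • 1 - createFst g * star (createFst f) := by
  rw [star_createFst_eq, createFst, hmap_mul, hmap_mul, star_create_mul_create, parity_mul_parity,
    sub_eq_add_neg, hmap_add_left, hmap_neg_left, hmap_smul_left, hmap_one, ← sub_eq_add_neg]

theorem star_createSnd_mul (f g : H) :
    star (createSnd f) * createSnd g = ⟪f, g⟫_ℂ • 1 - createSnd g * star (createSnd f) := by
  rw [star_createSnd_eq, createSnd, hmap_mul, hmap_mul, star_create_mul_create, one_mul,
    sub_eq_add_neg, hmap_add_right, hmap_neg_right, hmap_smul_right, hmap_one, ← sub_eq_add_neg]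

/-- The twist by `Γ` turns commutation of operators in different factors into anticommutation, so
the two families together represent the CAR over `H ⊕ H`. -/
theorem createFst_mul_createSnd (f g : H) :
    createFst f * createSnd g = -(createSnd g * createFst f) := by
  rw [createFst, createSnd, hmap_mul, hmap_mul, parity_mul_create, hmap_neg_right, one_mul, mul_one]

theorem star_create_mul_parity (f : H) :
    star (create f) * parity H = -(parity H * star (create f)) := by
  have h := congrArg star (parity_mul_create f)
  rwa [star_mul, star_neg, star_mul, star_parity] at h

theorem createFst_mul_star_createSnd (f g : H) :
    createFst f * star (createSnd g) = -(star (createSnd g) * createFst f) := by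
  rw [star_createSnd_eq, createFst, hmap_mul, hmap_mul, star_create_mul_parity, hmap_neg_right,
    one_mul, mul_one, neg_neg]

variable (H) in
theorem doubleParity_mul_self : doubleParity H * doubleParity H = 1 := by
  rw [doubleParity, hmap_mul, parity_mul_parity, hmap_one]

variable (H) in
theorem star_doubleParity : star (doubleParity H) = doubleParity H := by
  rw [doubleParity, star_hmap, star_parity]

theorem doubleParity_mul_createFst (f : H) :
    doubleParity H * createFst f = -(createFst f * doubleParity H) := by
  rw [doubleParity, createFst, hmap_mul, hmap_mul, parity_mul_create, hmap_neg_left]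

theorem doubleParity_mul_createSnd (f : H) :
    doubleParity H * createSnd f = -(createSnd f * doubleParity H) := by
  rw [doubleParity, createSnd, hmap_mul, hmap_mul, parity_mul_create, hmap_neg_right, one_mul,
    mul_one]

theorem doubleParity_mul_star_createFst (f : H) :
    doubleParity H * star (createFst f) = -(star (createFst f) * doubleParity H) := by
  have h := congrArg star (doubleParity_mul_createFst f)
  rw [star_mul, star_neg, star_mul, star_doubleParity] at h
  rw [h, neg_neg]

theorem doubleParity_mul_star_createSnd (f : H) :
    doubleParity H * star (createSnd f) = -(star (createSnd f) * doubleParity H) := by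
  have h := congrArg star (doubleParity_mul_createSnd f)
  rw [star_mul, star_neg, star_mul, star_doubleParity] at h
  rw [h, neg_neg]

theorem star_createFst_doubleVacuum (f : H) : star (createFst f) (doubleVacuum H) = 0 := by
  rw [star_createFst_eq, doubleVacuum, hmap_htmul, star_create_vacuum, htmul_zero_left]

theorem star_createSnd_doubleVacuum (f : H) : star (createSnd f) (doubleVacuum H) = 0 := by
  rw [star_createSnd_eq, doubleVacuum, hmap_htmul, star_create_vacuum, htmul_zero_right]

variable (H) in
theorem doubleParity_doubleVacuum : doubleParity H (doubleVacuum H) = doubleVacuum H := by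
  rw [doubleParity, doubleVacuum, hmap_htmul, parity_vacuum]

/-- Take the expectation of `a* a + a a* = ‖f‖²` in `z`. The identity both bounds `a*` and prevents
`a z` and `a* z` from being small together. -/
theorem norm_sq_add_norm_sq_of_car {X : Type*} [NormedAddCommGroup X] [InnerProductSpace ℂ X]
    [CompleteSpace X] {f : H} {a : X →L[ℂ] X} (ha : star a * a = ⟪f, f⟫_ℂ • 1 - a * star a)
    (z : X) : ‖a z‖ ^ 2 + ‖star a z‖ ^ 2 = ‖f‖ ^ 2 * ‖z‖ ^ 2 := by
  have h1 : ⟪z, star a (a z)⟫_ℂ = ⟪z, ⟪f, f⟫_ℂ • z - a (star a z)⟫_ℂ :=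
    congrArg (fun y => ⟪z, y⟫_ℂ) (DFunLike.congr_fun ha z)
  have h2 : ⟪z, a (star a z)⟫_ℂ = ⟪star a z, star a z⟫_ℂ := by
    rw [ContinuousLinearMap.star_eq_adjoint, ContinuousLinearMap.adjoint_inner_left]
  rw [inner_sub_right, inner_smul_right, h2, ContinuousLinearMap.star_eq_adjoint,
    ContinuousLinearMap.adjoint_inner_right] at h1
  simp only [inner_self_eq_norm_sq_to_K] at h1
  have h3 : ‖a z‖ ^ 2 = ‖f‖ ^ 2 * ‖z‖ ^ 2 - ‖ContinuousLinearMap.adjoint a z‖ ^ 2 := by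
    exact_mod_cast h1
  rw [ContinuousLinearMap.star_eq_adjoint, h3]
  ring

theorem norm_star_le_of_car {X : Type*} [NormedAddCommGroup X] [InnerProductSpace ℂ X]
    [CompleteSpace X] {f : H} {a : X →L[ℂ] X} (ha : star a * a = ⟪f, f⟫_ℂ • 1 - a * star a) :
    ‖star a‖ ≤ ‖f‖ := by
  refine ContinuousLinearMap.opNorm_le_bound _ (norm_nonneg _) fun z => ?_
  refine abs_le_of_sq_le_sq' ?_ (by positivity) |>.2
  rw [mul_pow, ← norm_sq_add_norm_sq_of_car ha z]
  exact le_add_of_nonneg_left (sq_nonneg _)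

/-- Strong convergence to zero of a bounded sequence is inherited by the closed span. -/
theorem isClosed_tendsto_zero {X Y : Type*} [NormedAddCommGroup X] [NormedSpace ℂ X]
    [NormedAddCommGroup Y] [NormedSpace ℂ Y] {a : ℕ → X →L[ℂ] Y} {C : ℝ} (ha : ∀ n, ‖a n‖ ≤ C) :
    IsClosed {z | Filter.Tendsto (fun n => a n z) Filter.atTop (nhds 0)} := by
  refine isClosed_of_closure_subset fun z hz => ?_
  rw [Set.mem_ofPred_eq, Metric.tendsto_atTop]
  intro ε hε
  have hC : 0 ≤ C := (norm_nonneg _).trans (ha 0)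
  -- The denominator is `C + 1` because `C` may be zero.
  obtain ⟨y, hy, hyz⟩ := Metric.mem_closure_iff.1 hz (ε / 2 / (C + 1)) (by positivity)
  obtain ⟨N, hN⟩ := Metric.tendsto_atTop.1 hy (ε / 2) (by positivity)
  refine ⟨N, fun n hn => ?_⟩
  have h1 := hN n hn
  rw [dist_zero_right] at h1 ⊢
  rw [dist_eq_norm, lt_div_iff₀ (by positivity)] at hyz
  have h2 : a n z = a n (z - y) + a n y := by rw [← map_add, sub_add_cancel]
  have h3 : ‖a n (z - y)‖ ≤ C * ‖z - y‖ := (a n).le_of_opNorm_le (ha n) _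
  have h4 : C * ‖z - y‖ ≤ ‖z - y‖ * (C + 1) := by nlinarith [norm_nonneg (z - y)]
  rw [h2]
  linarith [norm_add_le (a n (z - y)) (a n y)]

theorem tendsto_zero_of_wedge {a : ℕ → HTensor (Fock H) (Fock H) →L[ℂ] HTensor (Fock H) (Fock H)}
    {C : ℝ} (ha : ∀ n, ‖a n‖ ≤ C)
    (h : ∀ l l' : List H,
      Filter.Tendsto (fun n => a n (htmul (wedge l) (wedge l'))) Filter.atTop (nhds 0))
    (z : HTensor (Fock H) (Fock H)) :
    Filter.Tendsto (fun n => a n z) Filter.atTop (nhds 0) := by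
  let Z : Submodule ℂ (HTensor (Fock H) (Fock H)) :=
    { carrier := {z | Filter.Tendsto (fun n => a n z) Filter.atTop (nhds 0)}
      add_mem' := fun {x y} hx hy => by
        have hx' : Filter.Tendsto (fun n => a n x) Filter.atTop (nhds 0) := hx
        have hy' : Filter.Tendsto (fun n => a n y) Filter.atTop (nhds 0) := hy
        simpa using hx'.add hy'
      zero_mem' := by simp
      smul_mem' := fun c x hx => by
        have hx' : Filter.Tendsto (fun n => a n x) Filter.atTop (nhds 0) := hx
        simpa using hx'.const_smul c }
  refine htensor_mem_of_total (span_wedge_topologicalClosure_eq_top H)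
    (span_wedge_topologicalClosure_eq_top H) Z (isClosed_tendsto_zero ha) ?_ z
  rintro _ ⟨l, rfl⟩ _ ⟨l', rfl⟩
  exact h l l'

theorem tendsto_star_createFst {f : ℕ → H} {C : ℝ} (hC : ∀ n, ‖f n‖ ≤ C)
    (hf : ∀ g, Filter.Tendsto (fun n => ⟪f n, g⟫_ℂ) Filter.atTop (nhds 0))
    (z : HTensor (Fock H) (Fock H)) :
    Filter.Tendsto (fun n => star (createFst (f n)) z) Filter.atTop (nhds 0) := by
  refine tendsto_zero_of_wedge
    (fun n => (norm_star_le_of_car (star_createFst_mul (f n) (f n))).trans (hC n))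
    (fun l l' => ?_) z
  have h1 := (((htmulL (Fock H) (Fock H)).flip (parity H (wedge l'))).continuous.tendsto 0).comp
    (tendsto_star_create hf l)
  rw [map_zero] at h1
  refine h1.congr fun n => ?_
  rw [star_createFst_eq, hmap_htmul]
  rfl

theorem tendsto_star_createSnd {f : ℕ → H} {C : ℝ} (hC : ∀ n, ‖f n‖ ≤ C)
    (hf : ∀ g, Filter.Tendsto (fun n => ⟪f n, g⟫_ℂ) Filter.atTop (nhds 0))
    (z : HTensor (Fock H) (Fock H)) :
    Filter.Tendsto (fun n => star (createSnd (f n)) z) Filter.atTop (nhds 0) := by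
  refine tendsto_zero_of_wedge
    (fun n => (norm_star_le_of_car (star_createSnd_mul (f n) (f n))).trans (hC n))
    (fun l l' => ?_) z
  have h1 := ((htmulL (Fock H) (Fock H) (wedge l)).continuous.tendsto 0).comp
    (tendsto_star_create hf l')
  rw [map_zero] at h1
  refine h1.congr fun n => ?_
  rw [star_createSnd_eq, hmap_htmul]
  rfl

variable (H) in
-- Over the zero space only the vacuum survives. This settles `K = 0`, where there is no wandering
-- unit vector.
theorem doubleParity_eq_one [Subsingleton H] : doubleParity H = 1 := by
  refine htensor_ext_of_total (span_wedge_topologicalClosure_eq_top H)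
    (span_wedge_topologicalClosure_eq_top H) ?_
  have h : ∀ l : List H, parity H (wedge l) = wedge l := by
    intro l
    cases l with
    | nil => exact parity_vacuum
    | cons f l => rw [wedge_cons, Subsingleton.elim f 0, create_zero]; exact map_zero _
  rintro _ ⟨l, rfl⟩ _ ⟨l', rfl⟩
  rw [doubleParity, hmap_htmul, h, h]
  rfl

/-! ### Even vectors killed by a set of annihilators -/

theorem inner_htmul_create_left {f : H} {v : HTensor (Fock H) (Fock H)}
    (h : star (createFst f) v = 0) (x y : Fock H) : ⟪htmul (create f x) y, v⟫_ℂ = 0 := by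
  have h1 : parity H (parity H y) = y := DFunLike.congr_fun (parity_mul_parity H) y
  have h2 : htmul (create f x) y = createFst f (htmul x (parity H y)) := by
    rw [createFst, hmap_htmul, h1]
  rw [h2, ← ContinuousLinearMap.adjoint_inner_right, ← ContinuousLinearMap.star_eq_adjoint, h,
    inner_zero_right]

theorem inner_htmul_create_right {f : H} {v : HTensor (Fock H) (Fock H)}
    (h : star (createSnd f) v = 0) (x y : Fock H) : ⟪htmul x (create f y), v⟫_ℂ = 0 := by
  have h2 : htmul x (create f y) = createSnd f (htmul x y) := by
    rw [createSnd, hmap_htmul]; rfl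
  rw [h2, ← ContinuousLinearMap.adjoint_inner_right, ← ContinuousLinearMap.star_eq_adjoint, h,
    inner_zero_right]

theorem doubleParity_htmul_wedgeFamily {P : Type*} [LinearOrder P] (w w' : P → H)
    (I₁ I₂ : Finset P) : doubleParity H (htmul (wedgeFamily w I₁) (wedgeFamily w' I₂)) =
      ((-1 : ℤ) ^ I₁.card * (-1) ^ I₂.card : ℤ) •
        htmul (wedgeFamily w I₁) (wedgeFamily w' I₂) := by
  rw [doubleParity, hmap_htmul, parity_wedgeFamily, parity_wedgeFamily]
  rcases neg_one_pow_eq_or ℤ I₁.card with h1 | h1 <;>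
    rcases neg_one_pow_eq_or ℤ I₂.card with h2 | h2 <;>
    have h1' := congrArg (Int.cast : ℤ → ℂ) h1 <;>
    have h2' := congrArg (Int.cast : ℤ → ℂ) h2 <;>
    push_cast at h1' h2' <;>
    simp [h1, h2, h1', h2', htmul_neg_left, htmul_neg_right]

/-- Eigenvectors of the self-adjoint `Γ ⊗ Γ` for the eigenvalues `-1` and `1` are orthogonal. -/
theorem inner_eq_zero_of_doubleParity {u v : HTensor (Fock H) (Fock H)}
    (hu : doubleParity H u = -u) (hv : doubleParity H v = v) : ⟪u, v⟫_ℂ = 0 := by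
  have h : ⟪doubleParity H u, v⟫_ℂ = ⟪u, v⟫_ℂ := by
    rw [← ContinuousLinearMap.adjoint_inner_right, ← ContinuousLinearMap.star_eq_adjoint,
      star_doubleParity, hv]
  rw [hu, inner_neg_left] at h
  exact self_eq_neg.1 h.symm

theorem eqOn_topologicalClosure_span {X Y : Type*} [NormedAddCommGroup X] [NormedSpace ℂ X]
    [NormedAddCommGroup Y] [NormedSpace ℂ Y] {S : Set X} (a b : X →L[ℂ] Y)
    (h : ∀ v ∈ S, a v = b v) : ∀ v ∈ (Submodule.span ℂ S).topologicalClosure, a v = b v :=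
  fun _ hv => Submodule.topologicalClosure_minimal
    (t := LinearMap.eqLocus a.toLinearMap b.toLinearMap) _ (Submodule.span_le.2 h)
    (isClosed_eq a.continuous b.continuous) hv

/-- An even vector killed by the annihilators of `V` lies in the span of the even tensors of the
vectors `w_I` and `w'_J`, where `w` and `w'` span complements of `V`. -/
theorem mem_closure_span_of_annihilated {P : Type*} [LinearOrder P] (w w' : P → H) (V : Set H)
    (hw : (Submodule.span ℂ (Set.range w ∪ V)).topologicalClosure = ⊤)
    (hw' : (Submodule.span ℂ (Set.range w' ∪ V)).topologicalClosure = ⊤)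
    (ho : ∀ f ∈ V, ∀ i, ⟪f, w i⟫_ℂ = 0) (ho' : ∀ f ∈ V, ∀ i, ⟪f, w' i⟫_ℂ = 0)
    {ξ : HTensor (Fock H) (Fock H)} (hξ : doubleParity H ξ = ξ)
    (h₁ : ∀ f ∈ V, star (createFst f) ξ = 0) (h₂ : ∀ f ∈ V, star (createSnd f) ξ = 0) :
    ξ ∈ (Submodule.span ℂ {v | ∃ I₁ I₂ : Finset P, (-1 : ℤ) ^ I₁.card = (-1) ^ I₂.card ∧
      v = htmul (wedgeFamily w I₁) (wedgeFamily w' I₂)}).topologicalClosure := by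
  set S := {v | ∃ I₁ I₂ : Finset P, (-1 : ℤ) ^ I₁.card = (-1) ^ I₂.card ∧
      v = htmul (wedgeFamily w I₁) (wedgeFamily w' I₂)} with hS
  set E := (Submodule.span ℂ S).topologicalClosure with hE
  have hEc : IsClosed (E : Set (HTensor (Fock H) (Fock H))) :=
    Submodule.isClosed_topologicalClosure _
  have : CompleteSpace E := hEc.completeSpace_coe
  have hpm : ∀ I₁ I₂ : Finset P, (-1 : ℤ) ^ I₁.card = (-1) ^ I₂.card →
      (-1 : ℤ) ^ I₁.card * (-1) ^ I₂.card = 1 := by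
    intro I₁ I₂ h
    rw [h, ← mul_pow]; simp
  have hpm' : ∀ I₁ I₂ : Finset P, (-1 : ℤ) ^ I₁.card ≠ (-1) ^ I₂.card →
      (-1 : ℤ) ^ I₁.card * (-1) ^ I₂.card = -1 := by
    intro I₁ I₂ h
    rcases neg_one_pow_eq_or ℤ I₁.card with h1 | h1 <;>
      rcases neg_one_pow_eq_or ℤ I₂.card with h2 | h2 <;> simp_all
  have hE₀ : ∀ v ∈ E, doubleParity H v = v := by
    refine eqOn_topologicalClosure_span (doubleParity H) 1 ?_
    rintro _ ⟨I₁, I₂, h, rfl⟩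
    rw [doubleParity_htmul_wedgeFamily, hpm _ _ h, one_smul]
    rfl
  have hE₁ : ∀ f ∈ V, ∀ v ∈ E, star (createFst f) v = 0 := by
    refine fun f hf => eqOn_topologicalClosure_span (star (createFst f)) 0 ?_
    rintro _ ⟨I₁, I₂, h, rfl⟩
    rw [star_createFst_eq, hmap_htmul, star_create_wedgeFamily_eq_zero (ho f hf), htmul_zero_left]
    rfl
  have hE₂ : ∀ f ∈ V, ∀ v ∈ E, star (createSnd f) v = 0 := by
    refine fun f hf => eqOn_topologicalClosure_span (star (createSnd f)) 0 ?_
    rintro _ ⟨I₁, I₂, h, rfl⟩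
    rw [star_createSnd_eq, hmap_htmul, star_create_wedgeFamily_eq_zero (ho' f hf),
      htmul_zero_right]
    rfl
  -- All vectors of `E` are even and annihilated, so the remainder `ξ - p` inherits both properties
  -- besides being orthogonal to `E`.
  set p : HTensor (Fock H) (Fock H) := E.starProjection ξ with hp
  have hpE : p ∈ E := E.starProjection_apply_mem ξ
  have hperp : ξ - p ∈ Eᗮ := E.sub_starProjection_mem_orthogonal ξ
  have h₀' : doubleParity H (ξ - p) = ξ - p := by rw [map_sub, hξ, hE₀ p hpE]
  have h₁' : ∀ f ∈ V, star (createFst f) (ξ - p) = 0 := fun f hf => by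
    rw [map_sub, h₁ f hf, hE₁ f hf p hpE, sub_zero]
  have h₂' : ∀ f ∈ V, star (createSnd f) (ξ - p) = 0 := fun f hf => by
    rw [map_sub, h₂ f hf, hE₂ f hf p hpE, sub_zero]
  -- Test the remainder on a total set: tensors with a factor created from `V` pair to zero by
  -- annihilation, odd tensors of the `w_I` and `w'_J` by parity, and even ones because they lie in
  -- `E`.
  have hzero : ξ - p = 0 := by
    refine htensor_eq_zero_of_total
      (span_wedgeFamily_union_topologicalClosure_eq_top w V hw)
      (span_wedgeFamily_union_topologicalClosure_eq_top w' V hw') fun x hx y hy => ?_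
    rcases hx with ⟨I₁, rfl⟩ | ⟨f, hf, x, rfl⟩
    · rcases hy with ⟨I₂, rfl⟩ | ⟨f, hf, y, rfl⟩
      · by_cases h : (-1 : ℤ) ^ I₁.card = (-1) ^ I₂.card
        · exact Submodule.mem_orthogonal E _ |>.1 hperp _
            (Submodule.le_topologicalClosure _ (Submodule.subset_span ⟨I₁, I₂, h, rfl⟩))
        · refine inner_eq_zero_of_doubleParity ?_ h₀'
          rw [doubleParity_htmul_wedgeFamily, hpm' _ _ h, neg_smul, one_smul]
      · exact inner_htmul_create_right (h₂' f hf) _ _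
    · exact inner_htmul_create_left (h₁' f hf) _ _
  rw [sub_eq_zero] at hzero
  rw [hzero]
  exact hpE

end DoubleFock


/-! ### The quasi-free representation and its commutant -/

section QuasiFree

variable {H : Type*} [NormedAddCommGroup H] [InnerProductSpace ℂ H]

/-- The quasi-free representation `a(C f) ⊗ Γ + 1 ⊗ a(q S f)*` of the CAR; here `S` and `C` play the
roles of `R^{1/2}` and `(1 - R)^{1/2}`. -/
def quasiFree (S C : H →L[ℂ] H) (q : H ≃ₗᵢ⋆[ℂ] H) (f : H) :
    HTensor (Fock H) (Fock H) →L[ℂ] HTensor (Fock H) (Fock H) :=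
  createFst (C f) + star (createSnd (q (S f)))

/-- The field `a(S f) ⊗ Γ - 1 ⊗ a(q C f)*`, which anticommutes with the quasi-free representation. -/
def dualField (S C : H →L[ℂ] H) (q : H ≃ₗᵢ⋆[ℂ] H) (f : H) :
    HTensor (Fock H) (Fock H) →L[ℂ] HTensor (Fock H) (Fock H) :=
  createFst (S f) - star (createSnd (q (C f)))

variable (S C : H →L[ℂ] H) (q : H ≃ₗᵢ⋆[ℂ] H)

theorem star_quasiFree (f : H) :
    star (quasiFree S C q f) = star (createFst (C f)) + createSnd (q (S f)) := by
  rw [quasiFree, star_add, star_star]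

theorem star_dualField (f : H) :
    star (dualField S C q f) = star (createFst (S f)) - createSnd (q (C f)) := by
  rw [dualField, star_sub, star_star]

theorem star_createSnd_anticomm (f g : H) :
    star (createSnd f) * star (createSnd g) = -(star (createSnd g) * star (createSnd f)) := by
  rw [← star_mul, createSnd_anticomm, star_neg, star_mul]

theorem dualField_mul_quasiFree (f g : H) :
    dualField S C q f * quasiFree S C q g = -(quasiFree S C q g * dualField S C q f) := by
  simp only [dualField, quasiFree, mul_add, add_mul, sub_mul, mul_sub]
  rw [createFst_anticomm (S f) (C g), createFst_mul_star_createSnd (S f), star_createSnd_anticomm,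
    createFst_mul_star_createSnd (C g)]
  abel

/-- Polarization: `q` preserves norms, and its antilinearity exchanges the two imaginary terms. -/
theorem inner_conj_conj (x y : H) : ⟪q x, q y⟫_ℂ = ⟪y, x⟫_ℂ := by
  have h1 : q x + q y = q (x + y) := (map_add q x y).symm
  have h2 : q x - q y = q (x - y) := (map_sub q x y).symm
  have h3 : q x - Complex.I • q y = q (x + Complex.I • y) := by
    rw [map_add, LinearIsometryEquiv.map_smulₛₗ, Complex.conj_I, neg_smul, sub_eq_add_neg]
  have h4 : q x + Complex.I • q y = q (x - Complex.I • y) := by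
    rw [map_sub, LinearIsometryEquiv.map_smulₛₗ, Complex.conj_I, neg_smul, sub_neg_eq_add]
  rw [← inner_conj_symm y x, inner_eq_sum_norm_sq_div_four, inner_eq_sum_norm_sq_div_four x y]
  simp only [RCLike.I_to_complex]
  rw [h1, h2, h3, h4, q.norm_map, q.norm_map, q.norm_map, q.norm_map]
  simp only [map_div₀, map_add, map_sub, map_mul, map_pow,
    RCLike.conj_ofReal, Complex.conj_I, map_ofNat]
  ring

/-- The two factors contribute the scalars `⟪S f, C g⟫` and `⟪C f, S g⟫`, which agree since `S` and
`C` are symmetric and commute; the minus sign in the dual field makes them cancel. -/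
theorem star_dualField_mul_quasiFree (hS : ∀ x y, ⟪S x, y⟫_ℂ = ⟪x, S y⟫_ℂ)
    (hC : ∀ x y, ⟪C x, y⟫_ℂ = ⟪x, C y⟫_ℂ) (hSC : ∀ x, S (C x) = C (S x)) (f g : H) :
    star (dualField S C q f) * quasiFree S C q g =
      -(quasiFree S C q g * star (dualField S C q f)) := by
  have h1 : ⟪S f, C g⟫_ℂ = ⟪q (S g), q (C f)⟫_ℂ := by
    rw [inner_conj_conj, hS, hC, hSC]
  have h2 := star_createFst_mul (S f) (C g)
  have h3 := star_createSnd_mul (q (S g)) (q (C f))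
  have h4 : star (createFst (S f)) * star (createSnd (q (S g))) =
      -(star (createSnd (q (S g))) * star (createFst (S f))) := by
    rw [← star_mul, ← star_mul, ← star_neg, createFst_mul_createSnd, neg_neg]
  rw [star_dualField, quasiFree]
  simp only [mul_add, add_mul, sub_mul, mul_sub]
  rw [h2, h3, h4, createFst_mul_createSnd, h1]
  abel

theorem doubleParity_mul_quasiFree (f : H) :
    doubleParity H * quasiFree S C q f = -(quasiFree S C q f * doubleParity H) := by
  rw [quasiFree, mul_add, add_mul, doubleParity_mul_createFst, doubleParity_mul_star_createSnd]
  abel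

/-- The total parity also anticommutes with the representation, and the two signs cancel. This and
its adjoint version produce elements of the commutant of `M_R`. -/
theorem commute_quasiFree_dualField (f g : H) :
    Commute (dualField S C q f * doubleParity H) (quasiFree S C q g) := by
  rw [Commute, SemiconjBy, mul_assoc, doubleParity_mul_quasiFree, mul_neg, ← mul_assoc,
    dualField_mul_quasiFree, neg_mul, neg_neg, mul_assoc]

theorem commute_quasiFree_star_dualField (hS : ∀ x y, ⟪S x, y⟫_ℂ = ⟪x, S y⟫_ℂ)
    (hC : ∀ x y, ⟪C x, y⟫_ℂ = ⟪x, C y⟫_ℂ) (hSC : ∀ x, S (C x) = C (S x)) (f g : H) :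
    Commute (star (dualField S C q f * doubleParity H)) (quasiFree S C q g) := by
  rw [star_mul, star_doubleParity, Commute, SemiconjBy, mul_assoc,
    star_dualField_mul_quasiFree S C q hS hC hSC, mul_neg, ← mul_assoc, doubleParity_mul_quasiFree,
    neg_mul, neg_neg, mul_assoc]

/-- The two relations satisfied by `T (Ω ⊗ Ω)` when `T` commutes with the part of the quasi-free
representation and the part of its commutant belonging to the vector `k`. -/
theorem relations_of_commute (hSC : ∀ x, S (C x) = C (S x)) {k : H}
    {T : HTensor (Fock H) (Fock H) →L[ℂ] HTensor (Fock H) (Fock H)}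
    (h₁ : Commute T (quasiFree S C q (S k))) (h₂ : Commute T (star (quasiFree S C q (C k))))
    (h₃ : Commute T (dualField S C q (C k) * doubleParity H))
    (h₄ : Commute T (star (dualField S C q (S k) * doubleParity H))) :
    quasiFree S C q (S k) (T (doubleVacuum H)) =
        dualField S C q (C k) (doubleParity H (T (doubleVacuum H))) ∧
      star (quasiFree S C q (C k)) (T (doubleVacuum H)) =
        doubleParity H (star (dualField S C q (S k)) (T (doubleVacuum H))) := by
  have e₁ : T (quasiFree S C q (S k) (doubleVacuum H)) = quasiFree S C q (S k) (T (doubleVacuum H)) :=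
    DFunLike.congr_fun h₁.eq _
  have e₂ : T (star (quasiFree S C q (C k)) (doubleVacuum H)) =
      star (quasiFree S C q (C k)) (T (doubleVacuum H)) := DFunLike.congr_fun h₂.eq _
  have e₃ : T (dualField S C q (C k) (doubleParity H (doubleVacuum H))) =
      dualField S C q (C k) (doubleParity H (T (doubleVacuum H))) := DFunLike.congr_fun h₃.eq _
  rw [star_mul, star_doubleParity] at h₄
  have e₄ : T (doubleParity H (star (dualField S C q (S k)) (doubleVacuum H))) =
      doubleParity H (star (dualField S C q (S k)) (T (doubleVacuum H))) :=
    DFunLike.congr_fun h₄.eq _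
  have e₅ : doubleParity H (createSnd (q (C (S k))) (doubleVacuum H)) =
      -createSnd (q (C (S k))) (doubleParity H (doubleVacuum H)) :=
    DFunLike.congr_fun (doubleParity_mul_createSnd _) _
  rw [← e₁, ← e₂, ← e₃, ← e₄, doubleParity_doubleVacuum]
  constructor
  -- On the vacuum the annihilation parts drop out, and both sides reduce to `createFst (C (S k))`.
  · rw [quasiFree, dualField, add_apply, sub_apply, star_createSnd_doubleVacuum,
      star_createSnd_doubleVacuum, hSC, add_zero, sub_zero]
  -- Here both sides reduce to `createSnd (q (C (S k)))`; the sign in the dual field is absorbed by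
  -- the parity of a one-particle vector.
  · rw [star_quasiFree, star_dualField, add_apply, sub_apply, star_createFst_doubleVacuum,
      star_createFst_doubleVacuum, hSC, zero_add, zero_sub, map_neg, e₅, doubleParity_doubleVacuum,
      neg_neg]

/-- Adding to the relation its image under the total parity leaves only `ξ - Γ ⊗ Γ ξ`, twice the odd
part, and there the creation terms reinforce each other. -/
theorem odd_part_relation (hSC : ∀ x, S (C x) = C (S x)) {k : H} {ξ : HTensor (Fock H) (Fock H)}
    (h : quasiFree S C q (S k) ξ = dualField S C q (C k) (doubleParity H ξ)) :
    (2 : ℂ) • createFst (C (S k)) (ξ - doubleParity H ξ) =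
      star (createSnd (q (C (C k)))) (ξ - doubleParity H ξ) -
        star (createSnd (q (S (S k)))) (ξ - doubleParity H ξ) := by
  have hG : doubleParity H (doubleParity H ξ) = ξ := DFunLike.congr_fun (doubleParity_mul_self H) ξ
  have g₁ : ∀ (f : H) z, doubleParity H (createFst f z) = -createFst f (doubleParity H z) :=
    fun f z => DFunLike.congr_fun (doubleParity_mul_createFst f) z
  have g₂ : ∀ (f : H) z, doubleParity H (star (createSnd f) z) =
      -star (createSnd f) (doubleParity H z) :=
    fun f z => DFunLike.congr_fun (doubleParity_mul_star_createSnd f) z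
  rw [quasiFree, dualField, add_apply, sub_apply, hSC] at h
  have h' := congrArg (doubleParity H) h
  rw [map_add, map_sub, g₁, g₁, g₂, g₂, hG] at h'
  simp only [map_sub]
  linear_combination (norm := module) h + h'

/-- For even `ξ` the creation terms on the two sides agree and cancel; the annihilators of the `S²`
and `C²` parts then add up to that of the whole vector. -/
theorem even_relations (hSC : ∀ x, S (C x) = C (S x)) (h1 : ∀ x, S (S x) + C (C x) = x) {k : H}
    {ξ : HTensor (Fock H) (Fock H)} (hξ : doubleParity H ξ = ξ)
    (h : quasiFree S C q (S k) ξ = dualField S C q (C k) (doubleParity H ξ))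
    (h' : star (quasiFree S C q (C k)) ξ = doubleParity H (star (dualField S C q (S k)) ξ)) :
    star (createSnd (q k)) ξ = 0 ∧ star (createFst k) ξ = 0 := by
  have g₁ : ∀ (f : H) z, doubleParity H (star (createFst f) z) =
      -star (createFst f) (doubleParity H z) :=
    fun f z => DFunLike.congr_fun (doubleParity_mul_star_createFst f) z
  have g₂ : ∀ (f : H) z, doubleParity H (createSnd f z) = -createSnd f (doubleParity H z) :=
    fun f z => DFunLike.congr_fun (doubleParity_mul_createSnd f) z
  rw [quasiFree, dualField, add_apply, sub_apply, hSC, hξ] at h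
  rw [star_quasiFree, star_dualField, add_apply, sub_apply, map_sub, g₁, g₂, hξ, hSC] at h'
  constructor
  · conv_lhs => rw [← h1 k]
    rw [map_add, createSnd_add, star_add, add_apply]
    linear_combination (norm := module) h
  · conv_lhs => rw [← h1 k]
    rw [createFst_add, star_add, add_apply]
    linear_combination (norm := module) h'

/-- A vector satisfying the odd relations for a weakly null sequence is zero. -/
theorem eq_zero_of_odd_relations {k : ℕ → H} {c : ℝ} (hc : c ≠ 0)
    (hk : ∀ g, Filter.Tendsto (fun n => ⟪k n, g⟫_ℂ) Filter.atTop (nhds 0))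
    {B : ℝ} (hB : ∀ n, ‖k n‖ ≤ B) (hS : ∀ x y, ⟪S x, y⟫_ℂ = ⟪x, S y⟫_ℂ)
    (hC : ∀ x y, ⟪C x, y⟫_ℂ = ⟪x, C y⟫_ℂ) (hq : ∀ f, q (q f) = f)
    (hm : ∀ n, ‖C (S (k n))‖ = c) {η : HTensor (Fock H) (Fock H)}
    (h : ∀ n, (2 : ℂ) • createFst (C (S (k n))) η =
      star (createSnd (q (C (C (k n))))) η - star (createSnd (q (S (S (k n))))) η) : η = 0 := by
  have hb : ∀ D D' : H →L[ℂ] H, ∀ n, ‖q (D (D' (k n)))‖ ≤ ‖D‖ * (‖D'‖ * B) := fun D D' n => by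
    rw [LinearIsometryEquiv.norm_map]
    exact (D.le_opNorm _).trans (by gcongr; exact (D'.le_opNorm _).trans (by gcongr; exact hB n))
  have hnull : ∀ D : H →L[ℂ] H, (∀ x y, ⟪D x, y⟫_ℂ = ⟪x, D y⟫_ℂ) → ∀ g,
      Filter.Tendsto (fun n => ⟪q (D (D (k n))), g⟫_ℂ) Filter.atTop (nhds 0) := by
    intro D hD g
    have h1 : ∀ n, ⟪q (D (D (k n))), g⟫_ℂ = conj ⟪k n, D (D (q g))⟫_ℂ := fun n => by
      conv_lhs => rw [← hq g]
      rw [inner_conj_conj, ← hD, ← hD, inner_conj_symm]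
    simp only [h1]
    simpa using (hk (D (D (q g)))).star
  have t₁ := tendsto_star_createSnd (hb C C) (hnull C hC) η
  have t₂ := tendsto_star_createSnd (hb S S) (hnull S hS) η
  have t₃ := tendsto_star_createFst (f := fun n => C (S (k n))) (fun n => (hm n).le) (fun g => by
    simpa only [hS, hC] using hk (S (C g))) η
  -- The relation expresses creation as half a difference of annihilation terms, each tending to
  -- zero.
  have t₄ : Filter.Tendsto (fun n => createFst (C (S (k n))) η) Filter.atTop (nhds 0) := by
    have := (t₁.sub t₂).const_smul (2⁻¹ : ℂ)
    rw [sub_zero, smul_zero] at this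
    refine this.congr fun n => ?_
    rw [← h n, smul_smul]; simp
  have t₅ := (t₄.norm.pow 2).add (t₃.norm.pow 2)
  -- By the CAR the sum is constant in `n`, yet it tends to zero.
  have h5 : ∀ n, ‖createFst (C (S (k n))) η‖ ^ 2 + ‖star (createFst (C (S (k n)))) η‖ ^ 2 =
      c ^ 2 * ‖η‖ ^ 2 := fun n => by
    rw [norm_sq_add_norm_sq_of_car (star_createFst_mul _ _), hm n]
  simp only [h5] at t₅
  have h6 := tendsto_nhds_unique t₅ tendsto_const_nhds
  have h7 : c ^ 2 * ‖η‖ ^ 2 = 0 := by simpa using h6.symm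
  have h8 : ‖η‖ ^ 2 = 0 := (mul_eq_zero.1 h7).resolve_left (pow_ne_zero 2 hc)
  exact norm_eq_zero.1 (pow_eq_zero_iff two_ne_zero |>.1 h8)

end QuasiFree


/-! ### Application to the CAR flow -/

section Flow

variable {K : Type*} [NormedAddCommGroup K] [InnerProductSpace ℂ K]

theorem carOp_eq_quasiFree (R : OneParticle K →L[ℂ] OneParticle K)
    (q : OneParticle K ≃ₗᵢ⋆[ℂ] OneParticle K) (f : OneParticle K) :
    carOp R q f = quasiFree (CFC.sqrt R) (CFC.sqrt (1 - R)) q f := by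
  rw [quasiFree, star_createSnd_eq]
  rfl

/-- The operators commuting with `Y` and `Y*` form a norm-closed `*`-algebra, so it suffices to
check generators to place `Y` in the commutant of the generated `C*`-algebra. -/
theorem commute_of_mem_carFactor {R : OneParticle K →L[ℂ] OneParticle K}
    {q : OneParticle K ≃ₗᵢ⋆[ℂ] OneParticle K} {T Y : GNS K →L[ℂ] GNS K}
    (hT : T ∈ (carFactor R q : Set (GNS K →L[ℂ] GNS K))) (h : ∀ f, Commute Y (carOp R q f))
    (h' : ∀ f, Commute (star Y) (carOp R q f)) : Commute T Y := by
  have hT' : T ∈ Set.centralizer (Set.centralizer (carImage R q : Set (GNS K →L[ℂ] GNS K))) := hT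
  have hle : carImage R q ≤ StarSubalgebra.centralizer ℂ {Y} := by
    refine StarSubalgebra.topologicalClosure_minimal (StarAlgebra.adjoin_le ?_) ?_
    · rintro _ ⟨f, rfl⟩
      refine StarSubalgebra.mem_centralizer_iff ℂ |>.2 ?_
      rintro _ rfl
      exact ⟨(h f).eq, (h' f).eq⟩
    · rw [StarSubalgebra.coe_centralizer]
      exact Set.isClosed_centralizer _
  have hY : Y ∈ Set.centralizer (carImage R q : Set (GNS K →L[ℂ] GNS K)) := fun x hx =>
    ((StarSubalgebra.mem_centralizer_iff ℂ).1 (hle hx) Y rfl).1.symm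
  exact (hT' Y hY).symm

/-- From `A x = 0` follows `0 = ⟪A x, x⟫ ≥ ε ‖x‖²`. -/
theorem eq_zero_of_smul_one_le {X : Type*} [NormedAddCommGroup X] [InnerProductSpace ℂ X]
    {ε : ℝ} (hε : 0 < ε) {A : X →L[ℂ] X} (hA : (ε : ℂ) • (1 : X →L[ℂ] X) ≤ A) {x : X}
    (hx : A x = 0) : x = 0 := by
  have h := ((ContinuousLinearMap.le_def _ _).1 hA).re_inner_nonneg_left x
  rw [sub_apply, hx, zero_sub, smul_apply, inner_neg_left, one_apply_eq_self,
    inner_smul_left, Complex.conj_ofReal, inner_self_eq_norm_sq_to_K] at h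
  have h1 : 0 ≤ -(ε * ‖x‖ ^ 2) := by
    have : (RCLike.re (-((ε : ℂ) * ((‖x‖ : ℝ) : ℂ) ^ 2)) : ℝ) = -(ε * ‖x‖ ^ 2) := by
      rw [← Complex.ofReal_pow, ← Complex.ofReal_mul, ← Complex.ofReal_neg]
      exact Complex.ofReal_re _
    rw [← this]; exact h
  have h2 : ‖x‖ ^ 2 = 0 := by nlinarith [sq_nonneg ‖x‖]
  exact norm_eq_zero.1 (pow_eq_zero_iff two_ne_zero |>.1 h2)

theorem subsingleton_oneParticle [Subsingleton K] : Subsingleton (OneParticle K) := by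
  refine subsingleton_of_forall_eq 0 fun z => ?_
  refine (Submodule.mem_bot ℂ).1 (htensor_mem ⊥ isClosed_singleton (fun f k => ?_) z)
  rw [Subsingleton.elim k 0, htmul_zero_right]
  exact zero_mem _

/-- The continuous involution `q` carries the old generators to the new ones, since it maps the
range of the shift into itself. -/
theorem span_conj_union_range_shift {q : OneParticle K ≃ₗᵢ⋆[ℂ] OneParticle K}
    (hq : ∀ f, q (q f) = f) {t : ℝ≥0} (hqs : ∀ f, q (shift K t f) = shift K t (q f))
    {P : Type*} (w : P → OneParticle K)
    (hw : (Submodule.span ℂ (Set.range w ∪ Set.range (shift K t))).topologicalClosure = ⊤) :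
    (Submodule.span ℂ (Set.range (fun i => q (w i)) ∪
      Set.range (shift K t))).topologicalClosure = ⊤ := by
  set Z := Submodule.span ℂ (Set.range (fun i => q (w i)) ∪ Set.range (shift K t))
  have hZ : IsClosed (Z.topologicalClosure : Set (OneParticle K)) :=
    Submodule.isClosed_topologicalClosure _
  have hc : IsClosed ((Z.topologicalClosure.comap q.toLinearEquiv.toLinearMap :
      Submodule ℂ (OneParticle K)) : Set (OneParticle K)) := hZ.preimage q.continuous
  have hle : Submodule.span ℂ (Set.range w ∪ Set.range (shift K t)) ≤
      Z.topologicalClosure.comap q.toLinearEquiv.toLinearMap := by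
    refine Submodule.span_le.2 ?_
    rintro _ (⟨i, rfl⟩ | ⟨f, rfl⟩)
    · exact Submodule.le_topologicalClosure _ (Submodule.subset_span (Or.inl ⟨i, rfl⟩))
    · refine Submodule.le_topologicalClosure _ (Submodule.subset_span (Or.inr ⟨q f, ?_⟩))
      exact (hqs f).symm
  have htop := Submodule.topologicalClosure_minimal _ hle hc
  rw [hw] at htop
  refine eq_top_iff.2 fun z _ => ?_
  have h : q (q z) ∈ Z.topologicalClosure := htop (x := q z) Submodule.mem_top
  rwa [hq] at h

theorem commute_carOp_shift {R : OneParticle K →L[ℂ] OneParticle K}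
    {q : OneParticle K ≃ₗᵢ⋆[ℂ] OneParticle K}
    {α : ℝ≥0 → ((carFactor R q).toStarSubalgebra →⋆ₐ[ℂ] (carFactor R q).toStarSubalgebra)}
    (hα : IsCARFlow R q α) {t : ℝ≥0} {T : GNS K →L[ℂ] GNS K}
    (hT : T ∈ Set.centralizer
      (Set.range fun x => ((α t x : (carFactor R q).toStarSubalgebra) : GNS K →L[ℂ] GNS K)))
    (f : OneParticle K) :
    Commute T (carOp R q (shift K t f)) ∧ Commute T (star (carOp R q (shift K t f))) := by
  have h1 := hα.map_carOp t f
  constructor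
  · have h2 := hT _ ⟨⟨carOp R q f, carOp_mem R q f⟩, rfl⟩
    simp only [h1] at h2
    exact h2.symm
  · have h2 := hT _ ⟨star ⟨carOp R q f, carOp_mem R q f⟩, rfl⟩
    simp only [map_star, StarMemClass.coe_star, h1] at h2
    exact h2.symm

/-- The odd part of a vector satisfying the odd relations on the range of the shift vanishes. -/
theorem doubleParity_eq_self_of_relations {S C : OneParticle K →L[ℂ] OneParticle K}
    {q : OneParticle K ≃ₗᵢ⋆[ℂ] OneParticle K} (hSsymm : ∀ x y, ⟪S x, y⟫_ℂ = ⟪x, S y⟫_ℂ)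
    (hCsymm : ∀ x y, ⟪C x, y⟫_ℂ = ⟪x, C y⟫_ℂ) (hSC : ∀ x, S (C x) = C (S x))
    (hq : ∀ f, q (q f) = f) (hSs : ∀ s x, S (shift K s x) = shift K s (S x))
    (hCs : ∀ s x, C (shift K s x) = shift K s (C x)) (hinj : ∀ x, C (S x) = 0 → x = 0) {t : ℝ≥0}
    {ξ : GNS K} (h : ∀ f, quasiFree S C q (S (shift K t f)) ξ =
      dualField S C q (C (shift K t f)) (doubleParity _ ξ)) : doubleParity _ ξ = ξ := by
  rcases subsingleton_or_nontrivial K with hK | hK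
  · have := subsingleton_oneParticle (K := K)
    rw [doubleParity_eq_one]
    rfl
  · obtain ⟨u, hu, hu'⟩ := exists_norm_eq_one_orthogonal_shift_one (K := K)
    -- An operator commuting with the shifts has constant norm along a shift orbit; for `C * S` this
    -- provides the constant `c`.
    have hiter : ∀ D : OneParticle K →L[ℂ] OneParticle K,
        (∀ s x, D (shift K s x) = shift K s (D x)) → ∀ n x,
          ‖D ((shift K 1)^[n] x)‖ = ‖D x‖ := by
      intro D hD n x
      induction n with
      | zero => rfl
      | succ n ih => rw [Function.iterate_succ_apply', hD, norm_shift, ih]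
    have hc : ‖C (S u)‖ ≠ 0 := by
      intro h0
      have h5 : u = 0 := hinj u (norm_eq_zero.1 h0)
      rw [h5, norm_zero] at hu
      exact zero_ne_one hu
    -- The sequence is `s_t s_1ⁿ u`: the extra `s_t` is needed because the relations hold only on
    -- the range of `s_t`, and it preserves weak convergence to zero.
    have hodd := eq_zero_of_odd_relations S C q
      (k := fun n => shift K t ((shift K 1)^[n] u)) hc (fun g => by
        have h' := tendsto_inner_shift_pow hu hu' (star (shift K t) g)
        simpa only [ContinuousLinearMap.star_eq_adjoint,
          ContinuousLinearMap.adjoint_inner_right] using h')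
      (B := 1) (fun n => by
        have h' := hiter 1 (fun _ _ => rfl) n u
        rw [norm_shift]
        exact (h'.trans hu).le)
      hSsymm hCsymm hq
      (fun n => by
        rw [hSs, hCs, norm_shift]
        exact hiter (C * S) (fun s x => by
          change C (S _) = shift K s (C (S x))
          rw [hSs, hCs]) n u)
      (fun n => odd_part_relation S C q hSC (h _))
    exact (sub_eq_zero.1 hodd).symm

end Flow

end CAR
end

/-! ### The theorem -/

open CAR in
theorem mainTheorem4 {K : Type*} [NormedAddCommGroup K] [InnerProductSpace ℂ K] [CompleteSpace K]
    -- the data `R`, `q`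
    (R : OneParticle K →L[ℂ] OneParticle K)
    (q : OneParticle K ≃ₗᵢ⋆[ℂ] OneParticle K)
    (hq : ∀ f, q (q f) = f)
    (hqs : ∀ (t : ℝ≥0) (f : OneParticle K), q (shift K t f) = shift K t (q f))
    (ε : ℝ) (hε : 0 < ε)
    (hR₀ : (ε : ℂ) • (1 : OneParticle K →L[ℂ] OneParticle K) ≤ R)
    (hR₁ : R ≤ ((1 - ε : ℝ) : ℂ) • (1 : OneParticle K →L[ℂ] OneParticle K))
    {ι : Type*} (b : HilbertBasis ι ℂ K) (lam : ι → ℝ)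
    (hlam : ∀ i, lam i ∈ Set.Icc ε (1 - ε) \ {1 / 2})
    (hdiag : ∀ i (g : L2 (Set.Ioi 0)), R (htmul g (b i)) = (lam i : ℂ) • htmul g (b i))
    (hRs : ∀ (t : ℝ≥0) (f : OneParticle K), R (shift K t f) = shift K t (R f))
    -- the CAR flow on `M_R`
    (α : ℝ≥0 → ((carFactor R q).toStarSubalgebra →⋆ₐ[ℂ] (carFactor R q).toStarSubalgebra))
    (hα : IsCARFlow R q α)
    (t : ℝ≥0)
    -- an orthonormal basis of `L²(0, t) ⊗ K`
    {P : Type*} [LinearOrder P] (e : HilbertBasis P ℂ (Past K t))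
    (T : GNS K →L[ℂ] GNS K)
    (hT : T ∈ Set.centralizer
        (Set.range fun x => ((α t x : (carFactor R q).toStarSubalgebra) : GNS K →L[ℂ] GNS K)) ∩
      (carFactor R q : Set (GNS K →L[ℂ] GNS K))) :
    T (cyclicVector K) ∈ (Submodule.span ℂ
      {v : GNS K | ∃ I₁ I₂ : Finset P, (-1 : ℤ) ^ I₁.card = (-1) ^ I₂.card ∧
        v = htmul (wedgeFamily (fun i => pastIncl K t (e i)) I₁)
          (wedgeFamily (fun i => q (pastIncl K t (e i))) I₂)}).topologicalClosure := by
  have hone : (0 : OneParticle K →L[ℂ] OneParticle K) ≤ (ε : ℂ) • 1 := by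
    rw [ContinuousLinearMap.nonneg_iff_isPositive]
    exact ContinuousLinearMap.isPositive_one.smul_of_nonneg (by exact_mod_cast hε.le)
  have hR₂ : (ε : ℂ) • (1 : OneParticle K →L[ℂ] OneParticle K) ≤ 1 - R := by
    rw [ContinuousLinearMap.le_def] at hR₁ ⊢
    convert hR₁ using 1
    push_cast
    module
  have hRpos : 0 ≤ R := hone.trans hR₀
  have hRpos' : 0 ≤ 1 - R := hone.trans hR₂
  set S := CFC.sqrt R with hSdef
  set C := CFC.sqrt (1 - R) with hCdef
  have hSS : ∀ x, S (S x) = R x := DFunLike.congr_fun (CFC.sqrt_mul_sqrt_self R hRpos)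
  have hCC : ∀ x, C (C x) = x - R x := DFunLike.congr_fun (CFC.sqrt_mul_sqrt_self (1 - R) hRpos')
  have hcomm : ∀ Y : OneParticle K →L[ℂ] OneParticle K, Commute R Y → Commute S Y ∧ Commute C Y :=
    fun Y hY => ⟨hY.cfcₙ_nnreal _, ((Commute.one_left Y).sub_left hY).cfcₙ_nnreal _⟩
  have hSC : ∀ x, S (C x) = C (S x) :=
    DFunLike.congr_fun (hcomm C ((hcomm R (Commute.refl R)).2.symm)).1.eq
  have hSs : ∀ s x, S (shift K s x) = shift K s (S x) := fun s =>
    DFunLike.congr_fun (hcomm (shift K s) (ContinuousLinearMap.ext (hRs s))).1.eq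
  have hCs : ∀ s x, C (shift K s x) = shift K s (C x) := fun s =>
    DFunLike.congr_fun (hcomm (shift K s) (ContinuousLinearMap.ext (hRs s))).2.eq
  have hsymm : ∀ D : OneParticle K →L[ℂ] OneParticle K, 0 ≤ D → ∀ x y, ⟪D x, y⟫_ℂ = ⟪x, D y⟫_ℂ :=
    fun D hD => ((ContinuousLinearMap.nonneg_iff_isPositive D).1 hD).isSymmetric
  have hSsymm := hsymm S (CFC.sqrt_nonneg R)
  have hCsymm := hsymm C (CFC.sqrt_nonneg (1 - R))
  have hsum : ∀ x, S (S x) + C (C x) = x := fun x => by rw [hSS, hCC]; abel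
  -- Both `R` and `1 - R` are bounded below by `ε`; injectivity of `C S` makes the norm of `C S u`
  -- nonzero for the wandering vector `u`.
  have hinj : ∀ u, C (S u) = 0 → u = 0 := by
    intro u h0
    have h1 : S (C u) = 0 := by rw [hSC, h0]
    have h2 : R (C u) = 0 := by rw [← hSS, h1, map_zero]
    have h3 : C u = 0 := eq_zero_of_smul_one_le hε hR₀ h2
    have h4 : (1 - R) u = 0 := by
      change u - R u = 0
      rw [← hCC, h3, map_zero]
    exact eq_zero_of_smul_one_le hε hR₂ h4
  have hT₁ : ∀ f, Commute T (quasiFree S C q (shift K t f)) ∧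
      Commute T (star (quasiFree S C q (shift K t f))) := fun f => by
    rw [← carOp_eq_quasiFree]
    exact commute_carOp_shift hα hT.1 f
  have hT₂ : ∀ f, Commute T (dualField S C q f * doubleParity _) := fun f =>
    commute_of_mem_carFactor hT.2
      (fun g => by rw [carOp_eq_quasiFree]; exact commute_quasiFree_dualField S C q f g)
      (fun g => by
        rw [carOp_eq_quasiFree]
        exact commute_quasiFree_star_dualField S C q hSsymm hCsymm hSC f g)
  have hT₃ : ∀ f, Commute T (star (dualField S C q f * doubleParity _)) := fun f =>
    commute_of_mem_carFactor hT.2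
      (fun g => by
        rw [carOp_eq_quasiFree]
        exact commute_quasiFree_star_dualField S C q hSsymm hCsymm hSC f g)
      (fun g => by
        rw [carOp_eq_quasiFree, star_star]; exact commute_quasiFree_dualField S C q f g)
  -- Since `S` and `C` commute with the shift, `S k` and `C k` stay in its range, where `T` commutes
  -- with the representation.
  have hrel := fun f => relations_of_commute S C q hSC (k := shift K t f)
    (by rw [hSs]; exact (hT₁ _).1) (by rw [hCs]; exact (hT₁ _).2) (hT₂ _) (hT₃ _)
  change T (doubleVacuum _) ∈ _
  set ξ := T (doubleVacuum _)
  have heven : doubleParity _ ξ = ξ :=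
    doubleParity_eq_self_of_relations hSsymm hCsymm hSC hq hSs hCs hinj fun f => (hrel f).1
  have hann := fun f => even_relations S C q hSC hsum heven (hrel f).1 (hrel f).2
  have hw := span_pastIncl_union_range_shift t e e.dense_span
  refine mem_closure_span_of_annihilated _ _ (Set.range (shift K t)) hw
    (span_conj_union_range_shift hq (hqs t) _ hw) ?_ ?_ heven ?_ ?_
  · rintro _ ⟨f, rfl⟩ i
    rw [← inner_conj_symm, inner_pastIncl_shift, map_zero]
  · rintro _ ⟨f, rfl⟩ i
    -- Writing `s_t f` as `q (q (s_t f))` moves the conjugation off both arguments and leaves the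
    -- orthogonality of past and future.
    rw [← hq (shift K t f), inner_conj_conj, hqs, inner_pastIncl_shift]
  · rintro _ ⟨f, rfl⟩
    exact (hann f).2
  · rintro _ ⟨f, rfl⟩
    -- The second-factor relation concerns `q (s_t ·)`; at `q f` this is `s_t f`.
    have h := (hann (q f)).1
    rwa [hqs, hq] at h
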